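/- Let $\sigma_x,c_1,c_2>0$ be fixed. There is a constant $C_0>0$ depending only on $\sigma_x,c_1,c_2$ such that the following holds for every constant $C_1$, every fixed integer $k\ge 0$ and every constant $0\le\nu<1$. Consider a sequence of linear models $y=X\beta^*+\varepsilon$ with $X\in\mathbb R^{N\times n}$, $N\ge1$, along which $n\to\infty$ (the index of the sequence is suppressed; $N$, the graph, $\beta^*$ and all quantities below except $\sigma_x,c_1,c_2,C_0,C_1,k,\nu$ may change along it). Let $\mathcal G$ be a simple graph on $\{1,\dots,n\}$ with maximum degree $d\ge 2$ and $p$ edges, let $F\in\{-1,0,1\}^{p\times n}$ be its oriented incidence matrix (the row $F_j^T$ of an edge $(u,v)$, $u<v$, has $-1$ in entry $u$ and $+1$ in entry $v$), $L=F^TF$, and let $\Delta^{(k+1)}=FL^{k/2}$ for even $k$ and $\Delta^{(k+1)}=L^{(k+1)/2}$ for odd $k$. Assume: - $\|\Delta^{(k+1)}\beta^*\|_0\le s_1$ and $\|\beta^*\|_0\le s_2$, where $s_1,s_2\ge1$ are integers with $s_2/s_1\ge\nu$. - The rows of $X$ are i.i.d. with covariance matrix $\Sigma_x$ and are $\sigma_x$-sub-Gaussian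 (mean zero, and $\mathbb E\exp(t\,u^TX_i)\le\exp(\sigma_x^2t^2/2)$ for all $t\in\mathbb R$ and all unit vectors $u$); the eigenvalues of $\Sigma_x$ lie in $[c_1,c_2]$, and $\Theta_x=\Sigma_x^{-1}$ satisfies $\max_i\sum_j|(\Theta_x)_{ij}|\le M_n$. - $\varepsilon\sim N(0,\sigma_\varepsilon^2I_N)$ with $\sigma_\varepsilon>0$, independent of $X$. - $C_0\sigma_\varepsilon\sqrt{\log n/N}\le\lambda\le C_1\sigma_\varepsilon\sqrt{\log n/N}$, $\ \lambda_g=\lambda\sqrt{\nu/(2d)^{k+1}}$, and $C_0\sqrt{\log n/N}\le\mu\le C_1\sqrt{\log n/N}$. Let $\hat\beta$ be a (measurable) minimizer over $\beta\in\mathbb R^n$ of $\frac1{2N}\|y-X\beta\|_2^2+\lambda_g\|\Delta^{(k+1)}\beta\|_1+\lambda\|\beta\|_1$. Let $\Sigma_N=\frac1NX^TX$, and let $\widehat\Theta$ be a measurable function of $X$ which, whenever the feasible set is non-empty, minimizes $\sum_{i,j}|\Theta_{ij}|$ over the $\Theta\in\mathbb R^{n\times n}$ with $\max_{i,j}|(\Theta\Sigma_N-I_n)_{ij}|\le\mu$.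 Let $\tilde\beta=\hat\beta+\frac1N\widehat\Theta X^T(y-X\hat\beta)$ and $\hat\sigma_\varepsilon=\big(\frac1N\sum_{i=1}^N(y_i-X_i^T\hat\beta)^2\big)^{1/2}$. If $dM_n\sqrt{\log n/N}\to0$ and $s_2\log n\sqrt{d/N}\to0$, then for every choice of an edge $j$ of each graph, $$\frac{\sqrt N(F_j^T\tilde\beta-F_j^T\beta^*)}{\sigma_\varepsilon\sqrt{F_j^T\widehat\Theta\Sigma_N\widehat\Theta^TF_j}}\to N(0,1)\quad\text{and}\quad\frac{\sqrt N(F_j^T\tilde\beta-F_j^T\beta^*)}{\hat\sigma_\varepsilon\sqrt{F_j^T\widehat\Theta\Sigma_N\widehat\Theta^TF_j}}\to N(0,1)$$ in distribution. Consequently, let $0<\alpha<1$, let $\Phi$ be the standard normal distribution function, and suppose that $\beta^*_u=\beta^*_v$ for the chosen edges $j=(u,v)$. Then the test that rejects $\beta^*_u=\beta^*_v$ when $|Z'_j|>\Phi^{-1}(1-\alpha/2)$ has rejection probability tending to $\alpha$, both for $Z'_j=\sqrt N F_j^T\tilde\beta\big/\big(\sigma_\varepsilon\sqrt{F_j^T\widehat\Theta\Sigma_N\widehat\Theta^TF_j}\big)$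 and for $Z'_j=\sqrt N F_j^T\tilde\beta\big/\big(\hat\sigma_\varepsilon\sqrt{F_j^T\widehat\Theta\Sigma_N\widehat\Theta^TF_j}\big)$. -/

import Mathlib

open MeasureTheory ProbabilityTheory Filter Topology Matrix

namespace GraphLasso

noncomputable section

/-! ### Graph difference operators -/

/-- The edges of a graph on `Fin n`, each written as the pair `(i, j)` with `i < j`. -/
abbrev Edge {n : ℕ} (G : SimpleGraph (Fin n)) : Type :=
  {e : Fin n × Fin n // e.1 < e.2 ∧ G.Adj e.1 e.2}

/-- The oriented incidence matrix `F`: the row of the edge `(i, j)`, `i < j`, has `-1` in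
column `i`, `+1` in column `j` and `0` elsewhere. -/
def incidence {n : ℕ} (G : SimpleGraph (Fin n)) : Matrix (Edge G) (Fin n) ℝ :=
  Matrix.of fun e v => if v = e.1.1 then -1 else if v = e.1.2 then 1 else 0

/-- The graph Laplacian `L = Fᵀ F`. -/
def laplacian {n : ℕ} (G : SimpleGraph (Fin n)) [DecidableRel G.Adj] :
    Matrix (Fin n) (Fin n) ℝ :=
  (incidence G)ᵀ * incidence G

/-- The row index of the graph difference operator of order `k + 1`: edges for even `k`,
nodes for odd `k`. -/
def DiffRow {n : ℕ} (G : SimpleGraph (Fin n)) : ℕ → Type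
  | 0 => Edge G
  | 1 => Fin n
  | k + 2 => DiffRow G k

instance instFintypeDiffRow {n : ℕ} (G : SimpleGraph (Fin n)) [DecidableRel G.Adj] :
    ∀ k : ℕ, Fintype (DiffRow G k)
  | 0 => inferInstanceAs (Fintype (Edge G))
  | 1 => inferInstanceAs (Fintype (Fin n))
  | k + 2 => instFintypeDiffRow G k

/-- The graph difference operator `Δ^(k+1)` of order `k + 1`: it is `F L^(k/2)` for even `k` and
`L^((k+1)/2)` for odd `k`. -/
def graphDiff {n : ℕ} (G : SimpleGraph (Fin n)) [DecidableRel G.Adj] :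
    (k : ℕ) → Matrix (DiffRow G k) (Fin n) ℝ
  | 0 => incidence G
  | 1 => laplacian G
  | k + 2 => (graphDiff G k * laplacian G : Matrix (DiffRow G k) (Fin n) ℝ)

/-- The parameter space `S(k, s₁, s₂)` of vectors that are `(k, s₁)`-piecewise polynomial over the
graph and `s₂`-sparse. -/
def paramSpace {n : ℕ} (G : SimpleGraph (Fin n)) [DecidableRel G.Adj] (k s₁ s₂ : ℕ) :
    Set (Fin n → ℝ) :=
  {β | hammingNorm (graphDiff G k *ᵥ β) ≤ s₁ ∧ hammingNorm β ≤ s₂}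

/-! ### The random linear model -/

/-- A real random variable is `σ`-sub-Gaussian: it has mean zero and its moment generating
function is (finite and) at most `exp (σ² t² / 2)` for all `t`. -/
structure IsSubGaussian {Ω : Type*} [MeasurableSpace Ω] (σ : ℝ) (Z : Ω → ℝ) (P : Measure Ω) :
    Prop where
  mean_zero : ∫ ω, Z ω ∂P = 0
  mgf_bound : HasSubgaussianMGF Z (σ ^ 2).toNNReal P

/-- A random vector is `σ`-sub-Gaussian: it has mean zero and all its projections on unit vectors
are `σ`-sub-Gaussian. -/
structure IsSubGaussianVector {Ω : Type*} [MeasurableSpace Ω] {n : ℕ} (σ : ℝ)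
    (V : Ω → Fin n → ℝ) (P : Measure Ω) : Prop where
  mean_zero : ∀ a, ∫ ω, V ω a ∂P = 0
  projection : ∀ u : Fin n → ℝ, u ⬝ᵥ u = 1 → IsSubGaussian σ (fun ω => u ⬝ᵥ V ω) P

/-- `X` is a row-wise `(σ, S)`-sub-Gaussian random matrix: its rows are i.i.d. draws from a
`σ`-sub-Gaussian distribution with covariance matrix `S`. -/
structure IsRowwiseSubGaussian {Ω : Type*} [MeasurableSpace Ω] {N n : ℕ} (σ : ℝ)
    (S : Matrix (Fin n) (Fin n) ℝ) (X : Ω → Matrix (Fin N) (Fin n) ℝ) (P : Measure Ω) :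
    Prop where
  measurable_row : ∀ i, Measurable fun ω => X ω i
  indep_rows : iIndepFun (fun i ω => X ω i) P
  ident_rows : ∀ i i', IdentDistrib (fun ω => X ω i) (fun ω => X ω i') P P
  subGaussian_row : ∀ i, IsSubGaussianVector σ (fun ω => X ω i) P
  cov_row : ∀ i a b, covariance (fun ω => X ω i a) (fun ω => X ω i b) P = S a b

/-- `ε` has the law `N(0, σ² I_N)`: its components are i.i.d. `N(0, σ²)`. -/
structure IsGaussianNoise {Ω : Type*} [MeasurableSpace Ω] {N : ℕ} (σ : ℝ)
    (ε : Ω → Fin N → ℝ) (P : Measure Ω) : Prop where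
  measurable_noise : Measurable ε
  indep : iIndepFun (fun i ω => ε ω i) P
  law : ∀ i, P.map (fun ω => ε ω i) = gaussianReal 0 (σ ^ 2).toNNReal

/-! ### The estimators -/

/-- The objective `(2N)⁻¹ ‖y - X β‖₂² + lamG ‖Δ^(k+1) β‖₁ + lam ‖β‖₁`. -/
def objective {N n : ℕ} (G : SimpleGraph (Fin n)) [DecidableRel G.Adj] (k : ℕ) (lamG lam : ℝ)
    (X : Matrix (Fin N) (Fin n) ℝ) (y : Fin N → ℝ) (β : Fin n → ℝ) : ℝ :=
  1 / (2 * (N : ℝ)) * ∑ i, (y i - (X *ᵥ β) i) ^ 2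
    + lamG * ∑ r, |(graphDiff G k *ᵥ β) r| + lam * ∑ a, |β a|

/-- `βhat` is a `k`-th order Graph-Piecewise-Polynomial-Lasso estimate for the data `(X, y)`. -/
def IsGraphLasso {N n : ℕ} (G : SimpleGraph (Fin n)) [DecidableRel G.Adj] (k : ℕ)
    (lamG lam : ℝ) (X : Matrix (Fin N) (Fin n) ℝ) (y : Fin N → ℝ) (βhat : Fin n → ℝ) : Prop :=
  ∀ β : Fin n → ℝ, objective G k lamG lam X y βhat ≤ objective G k lamG lam X y β

/-- The sample covariance matrix `Σ_N = Xᵀ X / N`. -/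
def sampleCov {N n : ℕ} (X : Matrix (Fin N) (Fin n) ℝ) : Matrix (Fin n) (Fin n) ℝ :=
  (1 / (N : ℝ)) • (Xᵀ * X)

/-- The constraint `‖Θ S - I‖_∞ ≤ μ` (element-wise sup norm). -/
def CLIMEFeasible {n : ℕ} (S : Matrix (Fin n) (Fin n) ℝ) (μ : ℝ)
    (Θ : Matrix (Fin n) (Fin n) ℝ) : Prop :=
  ∀ a b, |(Θ * S - 1) a b| ≤ μ

/-- `Θ` solves the CLIME problem: it minimizes the element-wise `ℓ₁`-norm subject to the
constraint `‖Θ S - I‖_∞ ≤ μ`. -/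
def IsCLIME {n : ℕ} (S : Matrix (Fin n) (Fin n) ℝ) (μ : ℝ)
    (Θ : Matrix (Fin n) (Fin n) ℝ) : Prop :=
  CLIMEFeasible S μ Θ ∧
    ∀ Θ' : Matrix (Fin n) (Fin n) ℝ, CLIMEFeasible S μ Θ' →
      ∑ a, ∑ b, |Θ a b| ≤ ∑ a, ∑ b, |Θ' a b|

/-- A measurable selection `Θhat` of the CLIME estimator: a measurable function of the design
matrix that solves the CLIME problem for `Σ_N` whenever that problem has a feasible point (and
may take any value otherwise). -/
structure IsCLIMEEstimator {N n : ℕ} (μ : ℝ)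
    (Θhat : Matrix (Fin N) (Fin n) ℝ → Matrix (Fin n) (Fin n) ℝ) : Prop where
  measurable_entry : ∀ a b, Measurable fun x : Fin N → Fin n → ℝ => Θhat (Matrix.of x) a b
  solves : ∀ X : Matrix (Fin N) (Fin n) ℝ,
    (∃ Θ, CLIMEFeasible (sampleCov X) μ Θ) → IsCLIME (sampleCov X) μ (Θhat X)

/-- The one-step estimator `βhat + Θ Xᵀ (y - X βhat) / N`. -/
def oneStep {N n : ℕ} (X : Matrix (Fin N) (Fin n) ℝ) (y : Fin N → ℝ) (βhat : Fin n → ℝ)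
    (Θ : Matrix (Fin n) (Fin n) ℝ) : Fin n → ℝ :=
  βhat + (1 / (N : ℝ)) • ((Θ * Xᵀ) *ᵥ (y - X *ᵥ βhat))

/-- The noise level estimate `(N⁻¹ ∑ᵢ (yᵢ - Xᵢᵀ βhat)²)^(1/2)`. -/
def sigmaHat {N n : ℕ} (X : Matrix (Fin N) (Fin n) ℝ) (y : Fin N → ℝ) (βhat : Fin n → ℝ) : ℝ :=
  √(1 / (N : ℝ) * ∑ i, (y i - (X *ᵥ βhat) i) ^ 2)

/-- For the edge `e` with row `f` of the oriented incidence matrix, a noise level `s` and a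
centring `c`: the statistic `√N (fᵀ βtilde - c) / (s √(fᵀ Θ Σ_N Θᵀ f))`, where `βtilde` is the
one-step estimator. -/
def edgeStat {N n : ℕ} (G : SimpleGraph (Fin n)) (e : Edge G) (s c : ℝ)
    (X : Matrix (Fin N) (Fin n) ℝ) (y : Fin N → ℝ) (βhat : Fin n → ℝ)
    (Θ : Matrix (Fin n) (Fin n) ℝ) : ℝ :=
  √(N : ℝ) * (incidence G e ⬝ᵥ oneStep X y βhat Θ - c)
    / (s * √(incidence G e ⬝ᵥ ((Θ * sampleCov X * Θᵀ) *ᵥ incidence G e)))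

end

end GraphLasso

/-! Write `f` for the incidence row of the edge, `h = βhat - β*`, `q = X Θhatᵀ f` and `r = √(log n /
N)`. The one-step error splits exactly as `fᵀ(βtilde - β*) = ⟨q, ε⟩ / N - fᵀ(Θhat Σ_N - 1) h`, and
the variance `fᵀ Θhat Σ_N Θhatᵀ f` equals `|q|² / N`. After normalisation the first term is `⟨q /
|q|, ε⟩ / σ`. Since `q` depends on `X` only and `ε` is independent of `X`, this is exactly standard
normal for every sample size, so no central limit theorem is needed; the rest shows that the
remainder vanishes in probability.

The remainder is at most a constant times `√N μ ‖h‖₁ / σ`, because `‖f‖₁ = 2`, the CLIME constraint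
bounds the entries of `Θhat Σ_N - 1`, and the variance is bounded below by Cauchy–Schwarz
(`sandwich_variance_ge`). With `μ ≲ r` and `‖h‖₁ ≲ σ r s₂` it has order `s₂ log n / √N`, which tends
to zero.

The `ℓ₁` bound is a lasso argument (`IsGraphLasso.basic_inequality`,
`error_bounds_of_basic_inequality`). As `‖Δ h‖² ≤ (2d)^(k+1) ‖h‖²`, the scaling of the graph penalty
and `ν s₁ ≤ s₂` make its contribution at most `λ √s₂ ‖h‖₂`, the size of the sparsity term. Entrywise
closeness of `Σ_N` to `Σ_x` and `s₂ r → 0` give the restricted eigenvalue bound.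

The random input is a Bernstein inequality for products of sub-Gaussian variables
(`measureReal_abs_average_mul_sub_le`) and Gaussian tails, combined by a union bound of total
failure probability at most `10 / n`. The same inequality shows that `Σ_x⁻¹` is CLIME-feasible. For
the estimated noise level, `sigmaHat` has relative error of order `r √s₂` while the statistic is of
order `√(log n)`, so the change is again of order `s₂ log n / √N`. -/

namespace GraphLasso

/-! ### Exponential moments and a Bernstein inequality for products -/

section Bernstein

variable {Ω : Type*} [MeasurableSpace Ω] {P : Measure Ω}

lemma lintegral_exp_sq_gaussianReal_le :
    ∫⁻ g, ENNReal.ofReal (Real.exp (g ^ 2 / 4)) ∂(gaussianReal 0 1) ≤ 2 := by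
  rw [gaussianReal_of_var_ne_zero _ one_ne_zero,
    lintegral_withDensity_eq_lintegral_mul _ (measurable_gaussianPDF 0 1) (by fun_prop)]
  have h : ∀ g : ℝ, (gaussianPDF 0 1 * fun g => ENNReal.ofReal (Real.exp (g ^ 2 / 4))) g
      = ENNReal.ofReal ((√(2 * Real.pi))⁻¹ * Real.exp (-(1 / 4) * g ^ 2)) := by
    intro g
    rw [Pi.mul_apply, gaussianPDF, ← ENNReal.ofReal_mul (gaussianPDFReal_nonneg _ _ _),
      gaussianPDFReal, mul_assoc, ← Real.exp_add]
    simp only [NNReal.coe_one, mul_one, sub_zero]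
    congr 3
    ring
  simp_rw [h]
  rw [← ofReal_integral_eq_lintegral_ofReal
    ((integrable_exp_neg_mul_sq (by norm_num)).const_mul _) (ae_of_all _ fun x => by positivity),
    integral_const_mul, integral_gaussian]
  have h2 : (√(2 * Real.pi))⁻¹ * √(Real.pi / (1 / 4)) ≤ 2 := by
    rw [← Real.sqrt_inv, ← Real.sqrt_mul (by positivity)]
    rw [Real.sqrt_le_left (by norm_num)]
    have := Real.pi_pos
    field_simp
    norm_num
  calc _ ≤ ENNReal.ofReal 2 := ENNReal.ofReal_le_ofReal h2
    _ = 2 := by simp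

/-- Gaussian linearisation: `exp (U² / (4α²))` is the mean of `exp (U g / (√2 α))` over a standard
normal `g`. After Tonelli, the sub-Gaussian bound in `U` leaves `exp (g² / 4)`, whose Gaussian mean
is `√2`. -/
lemma lintegral_exp_sq_le [IsProbabilityMeasure P] {U : Ω → ℝ} {α : ℝ} (hα : 0 < α)
    (hU : HasSubgaussianMGF U (α ^ 2).toNNReal P) :
    ∫⁻ ω, ENNReal.ofReal (Real.exp (U ω ^ 2 / (4 * α ^ 2))) ∂P ≤ 2 := by
  have h1 : ∀ ω, ENNReal.ofReal (Real.exp (U ω ^ 2 / (4 * α ^ 2))) =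
      ∫⁻ g, ENNReal.ofReal (Real.exp (U ω / (√2 * α) * g)) ∂(gaussianReal 0 1) := by
    intro ω
    rw [← ofReal_integral_eq_lintegral_ofReal (integrable_exp_mul_gaussianReal _)
      (ae_of_all _ fun x => by positivity)]
    have := congrFun (mgf_fun_id_gaussianReal (μ := 0) (v := 1)) (U ω / (√2 * α))
    rw [mgf] at this
    rw [this]
    congr 2
    rw [div_pow, mul_pow, Real.sq_sqrt (by norm_num)]
    simp only [NNReal.coe_one]
    field_simp
    ring
  simp_rw [h1]
  rw [lintegral_lintegral_swap]
  · refine le_trans (lintegral_mono fun g => ?_) lintegral_exp_sq_gaussianReal_le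
    have h2 : ∀ ω, Real.exp (U ω / (√2 * α) * g) = Real.exp (g / (√2 * α) * U ω) := by
      intro ω; congr 1; ring
    simp_rw [h2]
    rw [← ofReal_integral_eq_lintegral_ofReal (hU.integrable_exp_mul _)
      (ae_of_all _ fun x => by positivity)]
    refine ENNReal.ofReal_le_ofReal ((hU.mgf_le _).trans (le_of_eq ?_))
    congr 1
    rw [div_pow, mul_pow, Real.sq_sqrt (by norm_num), Real.coe_toNNReal _ (by positivity)]
    field_simp
    ring
  · have := hU.aemeasurable
    have h3 : AEMeasurable (fun p : Ω × ℝ => U p.1) (P.prod (gaussianReal 0 1)) :=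
      this.comp_quasiMeasurePreserving Measure.quasiMeasurePreserving_fst
    exact ((h3.div_const _).mul measurable_snd.aemeasurable).exp.ennreal_ofReal

/-- With `a = U/α` and `b = V/β`, apply `|ab| / 4 ≤ a²/8 + b²/8` and then AM-GM to the two
exponentials. No independence of `U` and `V` is needed, which allows two coordinates of the same
row. -/
lemma integral_exp_abs_mul_le [IsProbabilityMeasure P] {U V : Ω → ℝ} {α β : ℝ} (hα : 0 < α)
    (hβ : 0 < β) (hU : HasSubgaussianMGF U (α ^ 2).toNNReal P)
    (hV : HasSubgaussianMGF V (β ^ 2).toNNReal P) :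
    Integrable (fun ω => Real.exp |U ω * V ω / (4 * α * β)|) P ∧
      ∫ ω, Real.exp |U ω * V ω / (4 * α * β)| ∂P ≤ 2 := by
  have hmU := hU.aemeasurable
  have hmV := hV.aemeasurable
  have hm : AEMeasurable (fun ω => Real.exp |U ω * V ω / (4 * α * β)|) P :=
    (((hmU.mul hmV).div_const _).abs).exp
  have key : ∀ ω, Real.exp |U ω * V ω / (4 * α * β)| ≤
      1 / 2 * Real.exp (U ω ^ 2 / (4 * α ^ 2)) + 1 / 2 * Real.exp (V ω ^ 2 / (4 * β ^ 2)) := by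
    intro ω
    set a := U ω / α
    set b := V ω / β
    have e1 : U ω * V ω / (4 * α * β) = a * b / 4 := by simp only [a, b]; field_simp
    have e2 : U ω ^ 2 / (4 * α ^ 2) = a ^ 2 / 4 := by simp only [a]; field_simp
    have e3 : V ω ^ 2 / (4 * β ^ 2) = b ^ 2 / 4 := by simp only [b]; field_simp
    rw [e1, e2, e3]
    have h1 : |a * b / 4| ≤ a ^ 2 / 8 + b ^ 2 / 8 := by
      rw [abs_le]; constructor <;> nlinarith [sq_nonneg (a - b), sq_nonneg (a + b)]
    have h2 : Real.exp (a ^ 2 / 8 + b ^ 2 / 8) = Real.exp (a ^ 2 / 8) * Real.exp (b ^ 2 / 8) :=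
      Real.exp_add _ _
    have h3 : Real.exp (a ^ 2 / 4) = Real.exp (a ^ 2 / 8) ^ 2 := by
      rw [sq (Real.exp _), ← Real.exp_add]; congr 1; ring
    have h4 : Real.exp (b ^ 2 / 4) = Real.exp (b ^ 2 / 8) ^ 2 := by
      rw [sq (Real.exp _), ← Real.exp_add]; congr 1; ring
    have h5 := Real.exp_le_exp.2 h1
    nlinarith [sq_nonneg (Real.exp (a ^ 2 / 8) - Real.exp (b ^ 2 / 8))]
  have hl : ∫⁻ ω, ENNReal.ofReal (Real.exp |U ω * V ω / (4 * α * β)|) ∂P ≤ 2 := by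
    calc _ ≤ ∫⁻ ω, (ENNReal.ofReal (1 / 2) * ENNReal.ofReal (Real.exp (U ω ^ 2 / (4 * α ^ 2)))
          + ENNReal.ofReal (1 / 2) * ENNReal.ofReal (Real.exp (V ω ^ 2 / (4 * β ^ 2)))) ∂P := by
          refine lintegral_mono fun ω => ?_
          rw [← ENNReal.ofReal_mul (by norm_num), ← ENNReal.ofReal_mul (by norm_num),
            ← ENNReal.ofReal_add (by positivity) (by positivity)]
          exact ENNReal.ofReal_le_ofReal (key ω)
      _ ≤ ENNReal.ofReal (1 / 2) * 2 + ENNReal.ofReal (1 / 2) * 2 := by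
          rw [lintegral_add_left', lintegral_const_mul', lintegral_const_mul']
          · gcongr
            · exact lintegral_exp_sq_le hα hU
            · exact lintegral_exp_sq_le hβ hV
          · simp
          · simp
          · exact (((hmU.pow_const 2).div_const _).exp.ennreal_ofReal).const_mul _
      _ = 2 := by
          rw [← two_mul, mul_comm _ (2 : ENNReal), ← mul_assoc]
          have : (2 : ENNReal) = ENNReal.ofReal 2 := by simp
          rw [this, ← ENNReal.ofReal_mul (by norm_num), ← ENNReal.ofReal_mul (by norm_num)]
          norm_num
  have hi : Integrable (fun ω => Real.exp |U ω * V ω / (4 * α * β)|) P := by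
    refine ⟨hm.aestronglyMeasurable, ?_⟩
    rw [hasFiniteIntegral_iff_ofReal (ae_of_all _ fun ω => by positivity)]
    exact hl.trans_lt (by simp)
  refine ⟨hi, ?_⟩
  rw [integral_eq_lintegral_of_nonneg_ae (ae_of_all _ fun ω => by positivity) hi.1]
  exact ENNReal.toReal_le_of_le_ofReal (by norm_num) (by simpa using hl)

/-- Second-order Taylor bound with remainder `(tz)² exp |tz|`. Since `|t| ≤ 1/2`, only `exp (|z|/2)`
is used up, and the other half of `exp |z|` absorbs `z² ≤ 8 exp (|z|/2)`. -/
lemma exp_mul_le_of_abs_le_half (z t : ℝ) (ht : |t| ≤ 1 / 2) :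
    Real.exp (t * z) ≤ 1 + t * z + 8 * t ^ 2 * Real.exp |z| := by
  have h1 := Complex.norm_exp_sub_sum_le_norm_mul_exp ((t * z : ℝ) : ℂ) 2
  have h2 : Complex.exp ((t * z : ℝ) : ℂ) - ∑ m ∈ Finset.range 2, ((t * z : ℝ) : ℂ) ^ m / m.factorial
      = ((Real.exp (t * z) - (1 + t * z) : ℝ) : ℂ) := by
    simp [Finset.sum_range_succ]
  rw [h2, Complex.norm_real, Complex.norm_real, Real.norm_eq_abs, Real.norm_eq_abs] at h1
  have h3 : Real.exp (t * z) - (1 + t * z) ≤ |t * z| ^ 2 * Real.exp |t * z| :=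
    (le_abs_self _).trans h1
  have h4 : Real.exp |t * z| ≤ Real.exp (|z| / 2) := by
    apply Real.exp_le_exp.2
    rw [abs_mul]
    nlinarith [abs_nonneg z]
  have h5 : z ^ 2 ≤ 8 * Real.exp (|z| / 2) := by
    have := Real.quadratic_le_exp_of_nonneg (x := |z| / 2) (by positivity)
    nlinarith [sq_abs z, abs_nonneg z]
  have h6 : Real.exp |z| = Real.exp (|z| / 2) * Real.exp (|z| / 2) := by
    rw [← Real.exp_add]; congr 1; ring
  have h7 : |t * z| ^ 2 * Real.exp |t * z| ≤ t ^ 2 * z ^ 2 * Real.exp (|z| / 2) := by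
    rw [sq_abs, mul_pow]; gcongr
  have h8 : t ^ 2 * z ^ 2 * Real.exp (|z| / 2) ≤ 8 * t ^ 2 * Real.exp |z| := by
    rw [h6]
    have := mul_le_mul_of_nonneg_left h5 (by positivity : 0 ≤ t ^ 2 * Real.exp (|z| / 2))
    nlinarith
  linarith

lemma integrable_exp_mul_of_exp_abs {Z : Ω → ℝ} (hZ : AEMeasurable Z P)
    (hi : Integrable (fun ω => Real.exp |Z ω|) P) {t : ℝ} (ht : |t| ≤ 1) :
    Integrable (fun ω => Real.exp (t * Z ω)) P := by
  refine hi.mono' (hZ.const_mul t).exp.aestronglyMeasurable (ae_of_all _ fun ω => ?_)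
  rw [Real.norm_eq_abs, Real.abs_exp]
  apply Real.exp_le_exp.2
  calc t * Z ω ≤ |t| * |Z ω| := by rw [← abs_mul]; exact le_abs_self _
    _ ≤ |Z ω| := mul_le_of_le_one_left (abs_nonneg _) ht

lemma integrable_of_exp_abs {Z : Ω → ℝ} (hZ : AEMeasurable Z P)
    (hi : Integrable (fun ω => Real.exp |Z ω|) P) : Integrable Z P := by
  refine hi.mono' hZ.aestronglyMeasurable (ae_of_all _ fun ω => ?_)
  rw [Real.norm_eq_abs]
  linarith [Real.add_one_le_exp |Z ω|]

lemma mgf_centered_le [IsProbabilityMeasure P] {Z : Ω → ℝ} (hZ : AEMeasurable Z P)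
    (hi : Integrable (fun ω => Real.exp |Z ω|) P) (h2 : ∫ ω, Real.exp |Z ω| ∂P ≤ 2)
    {t : ℝ} (ht : |t| ≤ 1 / 2) {κ : ℝ} (hκ : ∫ ω, Z ω ∂P = κ) :
    mgf (fun ω => Z ω - κ) P t ≤ Real.exp (16 * t ^ 2) := by
  have hZi := integrable_of_exp_abs hZ hi
  have h3 : ∫ ω, Real.exp (t * Z ω) ∂P ≤ 1 + t * κ + 16 * t ^ 2 := by
    calc _ ≤ ∫ ω, (1 + t * Z ω + 8 * t ^ 2 * Real.exp |Z ω|) ∂P := by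
          refine integral_mono (integrable_exp_mul_of_exp_abs hZ hi (by linarith)) ?_
            fun ω => exp_mul_le_of_abs_le_half _ _ ht
          exact ((integrable_const _).add (hZi.const_mul _)).add (hi.const_mul _)
      _ = 1 + t * κ + 8 * t ^ 2 * ∫ ω, Real.exp |Z ω| ∂P := by
          have e1 := integral_add (f := fun ω => 1 + t * Z ω)
            ((integrable_const (1 : ℝ)).add (hZi.const_mul t)) (hi.const_mul (8 * t ^ 2))
          rw [e1, integral_add (integrable_const _) (hZi.const_mul _), integral_const_mul,
            integral_const_mul, hκ]
          simp
      _ ≤ _ := by nlinarith [sq_nonneg t]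
  have h4 : mgf (fun ω => Z ω - κ) P t = Real.exp (-(t * κ)) * ∫ ω, Real.exp (t * Z ω) ∂P := by
    rw [mgf, ← integral_const_mul]
    congr 1; ext ω
    rw [← Real.exp_add]; ring_nf
  rw [h4]
  calc _ ≤ Real.exp (-(t * κ)) * Real.exp (t * κ + 16 * t ^ 2) := by
        gcongr
        refine h3.trans ?_
        linarith [Real.add_one_le_exp (t * κ + 16 * t ^ 2)]
    _ = _ := by rw [← Real.exp_add]; ring_nf

lemma measureReal_sum_ge_le [IsProbabilityMeasure P] {N : ℕ} {Z : Fin N → Ω → ℝ} {κ : ℝ}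
    (hind : iIndepFun Z P) (hZ : ∀ i, AEMeasurable (Z i) P)
    (hi : ∀ i, Integrable (fun ω => Real.exp |Z i ω|) P)
    (h2 : ∀ i, ∫ ω, Real.exp |Z i ω| ∂P ≤ 2) (hκ : ∀ i, ∫ ω, Z i ω ∂P = κ) {s : ℝ} (hs : 0 ≤ s)
    (hs16 : s ≤ 16) :
    P.real {ω | N * s ≤ ∑ i, (Z i ω - κ)} ≤ Real.exp (-(N * s ^ 2 / 64)) := by
  set t := s / 32 with ht
  have htn : |t| ≤ 1 / 2 := by rw [abs_of_nonneg (by positivity)]; linarith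
  have hind' : iIndepFun (fun i ω => Z i ω - κ) P :=
    hind.comp (fun _ z => z - κ) (fun _ => by fun_prop)
  have hm : ∀ i, AEMeasurable (fun ω => Z i ω - κ) P := fun i => (hZ i).sub_const _
  have hint : ∀ i, Integrable (fun ω => Real.exp (t * (Z i ω - κ))) P := by
    intro i
    have := (integrable_exp_mul_of_exp_abs (hZ i) (hi i) (t := t) (by linarith)).mul_const
      (Real.exp (-(t * κ)))
    refine this.congr (ae_of_all _ fun ω => ?_)
    simp only
    rw [← Real.exp_add]; congr 1; ring
  have hsum := hind'.mgf_sum₀ hm Finset.univ (t := t)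
  have hints : Integrable (fun ω => Real.exp (t * (∑ i, fun ω => Z i ω - κ) ω)) P := by
    -- The `mgf` takes the default value `0` when the exponential is not integrable, but by
    -- independence it equals a product of positive factors.
    by_contra hni
    have h0 : mgf (∑ i, fun ω => Z i ω - κ) P t = 0 := integral_undef hni
    rw [h0] at hsum
    exact (Finset.prod_pos fun i _ => mgf_pos (hint i)).ne hsum
  have h := measure_ge_le_exp_mul_mgf (X := ∑ i, fun ω => Z i ω - κ) (μ := P) (t := t)
    (N * s) (by positivity) hints
  have hset : {ω | N * s ≤ ∑ i, (Z i ω - κ)} = {ω | N * s ≤ (∑ i, fun ω => Z i ω - κ) ω} := by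
    ext ω; simp [Finset.sum_apply]
  rw [hset]
  refine h.trans ?_
  rw [hsum]
  calc _ ≤ Real.exp (-t * (N * s)) * ∏ _i : Fin N, Real.exp (16 * t ^ 2) := by
        gcongr with i
        · exact fun i _ => mgf_nonneg
        · exact mgf_centered_le (hZ i) (hi i) (h2 i) htn (hκ i)
    _ = _ := by
        rw [Finset.prod_const, ← Real.exp_nat_mul, ← Real.exp_add]
        congr 1
        simp [ht]
        ring

/-- Bernstein's inequality for averages of products of sub-Gaussian variables. -/
lemma measureReal_abs_average_mul_sub_le [IsProbabilityMeasure P] {N : ℕ} (hN : 0 < N)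
    {U V : Fin N → Ω → ℝ} {α β κ : ℝ} (hα : 0 < α) (hβ : 0 < β)
    (hind : iIndepFun (fun i ω => U i ω * V i ω) P)
    (hU : ∀ i, HasSubgaussianMGF (U i) (α ^ 2).toNNReal P)
    (hV : ∀ i, HasSubgaussianMGF (V i) (β ^ 2).toNNReal P)
    (hκ : ∀ i, ∫ ω, U i ω * V i ω ∂P = κ) {r : ℝ} (hr : 0 ≤ r) (hr1 : r ≤ 1) :
    P.real {ω | 64 * α * β * r < |1 / (N : ℝ) * ∑ i, U i ω * V i ω - κ|}
      ≤ 2 * Real.exp (-(4 * (N * r ^ 2))) := by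
  have hN' : (0 : ℝ) < N := by exact_mod_cast hN
  have hab : 0 < 4 * α * β := by positivity
  have hmUV : ∀ i, AEMeasurable (fun ω => U i ω * V i ω) P := fun i =>
    (hU i).aemeasurable.mul (hV i).aemeasurable
  -- Both signs of `c = ±1/(4αβ)` bring the products to unit exponential scale. Deviation `64αβr`
  -- becomes `s = 16r`, and `s²/64 = 4r²`.
  have one_sided : ∀ c : ℝ, |c| = (4 * α * β)⁻¹ →
      P.real {ω | N * (16 * r) ≤ ∑ i, (c * (U i ω * V i ω) - c * κ)}
        ≤ Real.exp (-(4 * (N * r ^ 2))) := by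
    intro c hc
    have habs : ∀ i ω, |c * (U i ω * V i ω)| = |U i ω * V i ω / (4 * α * β)| := by
      intro i ω
      rw [abs_mul, abs_div, hc, abs_of_pos hab]; ring
    have := measureReal_sum_ge_le (P := P) (Z := fun i ω => c * (U i ω * V i ω)) (κ := c * κ)
      (hind.comp (fun _ z => c * z) (fun _ => by fun_prop)) (fun i => (hmUV i).const_mul c)
      (fun i => by simpa only [habs] using (integral_exp_abs_mul_le hα hβ (hU i) (hV i)).1)
      (fun i => by simpa only [habs] using (integral_exp_abs_mul_le hα hβ (hU i) (hV i)).2)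
      (fun i => by rw [integral_const_mul, hκ]) (s := 16 * r) (by positivity) (by linarith)
    refine this.trans (le_of_eq ?_)
    congr 1; ring
  have hsub : {ω | 64 * α * β * r < |1 / (N : ℝ) * ∑ i, U i ω * V i ω - κ|} ⊆
      {ω | N * (16 * r) ≤ ∑ i, ((4 * α * β)⁻¹ * (U i ω * V i ω) - (4 * α * β)⁻¹ * κ)} ∪
      {ω | N * (16 * r) ≤ ∑ i, (-(4 * α * β)⁻¹ * (U i ω * V i ω) - -(4 * α * β)⁻¹ * κ)} := by
    intro ω hω
    simp only [Set.mem_ofPred_eq, Set.mem_union] at hω ⊢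
    set S := ∑ i, U i ω * V i ω
    have e : ∀ c : ℝ, ∑ i, (c * (U i ω * V i ω) - c * κ) = c * N * (1 / N * S - κ) := by
      intro c
      rw [Finset.sum_sub_distrib, ← Finset.mul_sum]
      simp only [Finset.sum_const, Finset.card_univ, Fintype.card_fin, nsmul_eq_mul]
      field_simp
      rfl
    rw [e, e]
    rcases lt_abs.1 hω with h | h
    · left
      rw [mul_comm _ (N : ℝ), mul_assoc]
      refine mul_le_mul_of_nonneg_left ?_ hN'.le
      rw [inv_mul_eq_div, le_div_iff₀ hab]
      linarith
    · right
      have : -(4 * α * β)⁻¹ * N * (1 / N * S - κ) = N * ((4 * α * β)⁻¹ * -(1 / N * S - κ)) := by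
        ring
      rw [this]
      refine mul_le_mul_of_nonneg_left ?_ hN'.le
      rw [inv_mul_eq_div, le_div_iff₀ hab]
      linarith
  refine (measureReal_mono hsub).trans ((measureReal_union_le _ _).trans ?_)
  have h1 := one_sided (4 * α * β)⁻¹ (abs_of_pos (by positivity))
  have h2 := one_sided (-(4 * α * β)⁻¹) (by rw [abs_neg]; exact abs_of_pos (by positivity))
  linarith

end Bernstein

/-! ### Gaussian projections, convergence in distribution and two-sided tests -/

section Gaussian

variable {Ω : Type*} [MeasurableSpace Ω] {P : Measure Ω}

/-- A fixed unit-length projection of isotropic Gaussian noise is Gaussian. -/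
lemma IsGaussianNoise.map_dotProduct [IsProbabilityMeasure P] {N : ℕ} {σ : ℝ}
    {ε : Ω → Fin N → ℝ} (hε : IsGaussianNoise σ ε P) {a : Fin N → ℝ} (ha : a ⬝ᵥ a = 1) :
    P.map (fun ω => a ⬝ᵥ ε ω) = gaussianReal 0 (σ ^ 2).toNNReal := by
  have hm : ∀ i, Measurable fun ω => ε ω i := fun i =>
    (measurable_pi_apply i).comp hε.measurable_noise
  have hind : iIndepFun (fun i ω => a i * ε ω i) P :=
    hε.indep.comp (fun i z => a i * z) (fun i => by fun_prop)
  have hlaw : ∀ i, P.map (fun ω => a i * ε ω i)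
      = gaussianReal 0 (NNReal.mk (a i ^ 2) (sq_nonneg _) * (σ ^ 2).toNNReal) := by
    intro i
    have h1 : P.map (fun ω => a i * ε ω i) = (P.map fun ω => ε ω i).map (fun z => a i * z) := by
      rw [Measure.map_map (by fun_prop) (hm i)]; rfl
    rw [h1, hε.law, gaussianReal_map_const_mul, mul_zero]
  have hmsum : Measurable fun ω => a ⬝ᵥ ε ω := by
    unfold dotProduct
    exact Finset.measurable_sum _ fun i _ => (hm i).const_mul _
  have := Measure.isProbabilityMeasure_map (μ := P) hmsum.aemeasurable
  apply Measure.ext_of_charFun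
  have hc := hind.charFun_map_fun_sum_eq_prod (fun i => ((hm i).const_mul _).aemeasurable)
  ext t
  have h2 : charFun (P.map fun ω => a ⬝ᵥ ε ω) t = ∏ i, charFun (P.map fun ω => a i * ε ω i) t := by
    have := congrFun hc t
    rwa [Finset.prod_apply] at this
  rw [h2]
  simp_rw [hlaw, charFun_gaussianReal]
  rw [← Complex.exp_sum]
  congr 1
  have h3 : ∑ i, ((a i : ℂ)) ^ 2 = 1 := by
    have : ∑ i, a i ^ 2 = 1 := by rw [← ha]; simp [dotProduct, sq]
    exact_mod_cast this
  simp only [NNReal.coe_mul, NNReal.coe_mk, Complex.ofReal_zero, mul_zero, zero_mul, zero_sub,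
    Complex.ofReal_mul, Complex.ofReal_pow]
  rw [Finset.sum_neg_distrib, ← Finset.sum_div, ← Finset.sum_mul, ← Finset.sum_mul, h3, one_mul]

/-- A unit-length projection of Gaussian noise along an independent random direction is standard
Gaussian after normalisation. -/
lemma IsGaussianNoise.map_dotProduct_of_indep [IsProbabilityMeasure P] {N : ℕ} {σ : ℝ}
    (hσ : 0 < σ) {E : Type*} [MeasurableSpace E] {ε : Ω → Fin N → ℝ} (hε : IsGaussianNoise σ ε P)
    {Y : Ω → E} (hY : Measurable Y) (hind : IndepFun Y ε P) {a : E → Fin N → ℝ}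
    (ham : Measurable a) (ha : ∀ x, a x ⬝ᵥ a x = 1) :
    P.map (fun ω => a (Y ω) ⬝ᵥ ε ω / σ) = gaussianReal 0 1 := by
  have hjoint := (indepFun_iff_map_prod_eq_prod_map_map hY.aemeasurable
    hε.measurable_noise.aemeasurable).1 hind
  have hg : Measurable fun p : E × (Fin N → ℝ) => a p.1 ⬝ᵥ p.2 / σ := by
    unfold dotProduct
    fun_prop
  have h1 : P.map (fun ω => a (Y ω) ⬝ᵥ ε ω / σ)
      = ((P.map Y).prod (P.map ε)).map (fun p => a p.1 ⬝ᵥ p.2 / σ) := by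
    rw [← hjoint, Measure.map_map hg (hY.prodMk hε.measurable_noise)]; rfl
  have := Measure.isProbabilityMeasure_map (μ := P) hY.aemeasurable
  have := Measure.isProbabilityMeasure_map (μ := P) hε.measurable_noise.aemeasurable
  rw [h1]
  ext s hs
  rw [Measure.map_apply hg hs, Measure.prod_apply (hg hs)]
  -- On each fibre `Y = x` the direction is fixed and the law is `N(0, 1)`, whatever `x` is;
  -- integrating over `x` then averages a constant.
  have h2 : ∀ x, (P.map ε) (Prod.mk x ⁻¹' ((fun p : E × (Fin N → ℝ) => a p.1 ⬝ᵥ p.2 / σ) ⁻¹' s))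
      = gaussianReal 0 1 s := by
    intro x
    have hgx : Measurable fun e : Fin N → ℝ => a x ⬝ᵥ e := by
      unfold dotProduct
      fun_prop
    have h3 : (P.map ε).map (fun e => a x ⬝ᵥ e / σ) = gaussianReal 0 1 := by
      rw [Measure.map_map (hgx.div_const _) hε.measurable_noise]
      have h4 : P.map ((fun e => a x ⬝ᵥ e / σ) ∘ ε)
          = (P.map fun ω => a x ⬝ᵥ ε ω).map (fun z => z / σ) := by
        have h5 : Measurable fun ω => a x ⬝ᵥ ε ω := hgx.comp hε.measurable_noise
        rw [Measure.map_map (by fun_prop) h5]; rfl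
      rw [h4, hε.map_dotProduct (ha x), gaussianReal_map_div_const, zero_div]
      congr 1
      ext
      rw [NNReal.coe_div, Real.coe_toNNReal _ (sq_nonneg _)]
      simp [hσ.ne']
    rw [← h3, Measure.map_apply (hgx.div_const _) hs]
    rfl
  simp_rw [h2]
  simp

lemma IsGaussianNoise.hasSubgaussianMGF [IsProbabilityMeasure P] {N : ℕ} {σ : ℝ}
    {ε : Ω → Fin N → ℝ} (hε : IsGaussianNoise σ ε P) (i : Fin N) :
    HasSubgaussianMGF (fun ω => ε ω i) (σ ^ 2).toNNReal P := by
  have hm : Measurable fun ω => ε ω i := (measurable_pi_apply i).comp hε.measurable_noise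
  refine ⟨fun t => ?_, fun t => ?_⟩
  · have h := integrable_exp_mul_gaussianReal (μ := 0) (v := (σ ^ 2).toNNReal) t
    rw [← hε.law i] at h
    exact h.comp_measurable hm
  · rw [mgf_gaussianReal (hε.law i)]
    simp

lemma IsGaussianNoise.integral_mul_self [IsProbabilityMeasure P] {N : ℕ} {σ : ℝ}
    {ε : Ω → Fin N → ℝ} (hε : IsGaussianNoise σ ε P) (i : Fin N) :
    ∫ ω, ε ω i * ε ω i ∂P = σ ^ 2 := by
  have hm : Measurable fun ω => ε ω i := (measurable_pi_apply i).comp hε.measurable_noise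
  have h1 : ∫ ω, ε ω i * ε ω i ∂P = ∫ x, x * x ∂(gaussianReal 0 (σ ^ 2).toNNReal) := by
    rw [← hε.law i, integral_map hm.aemeasurable (by fun_prop)]
  rw [h1]
  have h2 := variance_fun_id_gaussianReal (μ := 0) (v := (σ ^ 2).toNNReal)
  rw [variance_eq_integral (by fun_prop), integral_id_gaussianReal,
    Real.coe_toNNReal _ (sq_nonneg _)] at h2
  refine Eq.trans (integral_congr_ae (ae_of_all _ fun x => ?_)) h2
  ring

lemma measureReal_abs_gt_le_of_map_eq_gaussianReal [IsProbabilityMeasure P] {W : Ω → ℝ}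
    (hW : P.map W = gaussianReal 0 1) (hWm : AEMeasurable W P) {x : ℝ} (hx : 0 ≤ x) :
    P.real {ω | x < |W ω|} ≤ 2 * Real.exp (-(x ^ 2 / 2)) := by
  have hsg : HasSubgaussianMGF W 1 P := by
    refine ⟨fun t => ?_, fun t => ?_⟩
    · have h := integrable_exp_mul_gaussianReal (μ := 0) (v := 1) t
      rw [← hW] at h
      exact h.comp_aemeasurable hWm
    · rw [mgf_gaussianReal hW]
      simp
  have hsub : {ω | x < |W ω|} ⊆ {ω | x ≤ W ω} ∪ {ω | x ≤ (-W) ω} := by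
    intro ω hω
    rcases lt_abs.1 (show x < |W ω| from hω) with h | h
    · exact Or.inl h.le
    · exact Or.inr h.le
  refine (measureReal_mono hsub).trans ((measureReal_union_le _ _).trans ?_)
  have h1 := hsg.measure_ge_le hx
  have h2 := hsg.neg.measure_ge_le hx
  simp only [NNReal.coe_one, mul_one, neg_div] at h1 h2
  linarith

/-- If the laws of `W t` are standard normal and `T t - W t` vanishes in probability, then `T t`
is asymptotically standard normal. The probability space may change with `t`. -/
lemma tendstoInDistribution_gaussianReal_of_close {Ω : ℕ → Type*} [∀ t, MeasurableSpace (Ω t)]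
    {P : ∀ t, Measure (Ω t)} [∀ t, IsProbabilityMeasure (P t)] {T W : ∀ t, Ω t → ℝ}
    (hT : ∀ t, AEMeasurable (T t) (P t)) (hW : ∀ t, AEMeasurable (W t) (P t))
    (hlaw : ∀ t, (P t).map (W t) = gaussianReal 0 1) {η p : ℕ → ℝ} (hη : Tendsto η atTop (𝓝 0))
    (hp : Tendsto p atTop (𝓝 0))
    (hclose : ∀ᶠ t in atTop, (P t).real {ω | η t < |T t ω - W t ω|} ≤ p t) :
    TendstoInDistribution T atTop (id : ℝ → ℝ) P (gaussianReal 0 1) := by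
  refine ⟨hT, by fun_prop, tendsto_iff_forall_lipschitz_integral_tendsto.2 ?_⟩
  rintro F ⟨C, hC⟩ ⟨L, hL⟩
  have hFm : Measurable F := hL.continuous.measurable
  simp only [ProbabilityMeasure.coe_mk, Measure.map_id]
  rw [tendsto_iff_dist_tendsto_zero]
  have hlim : Tendsto (fun t => (L : ℝ) * |η t| + C * p t) atTop (𝓝 0) := by
    have := (hη.abs.const_mul (L : ℝ)).add (hp.const_mul C)
    simpa using this
  have hC0 : 0 ≤ C := dist_nonneg.trans (hC 0 0)
  refine squeeze_zero' (Eventually.of_forall fun t => dist_nonneg) ?_ hlim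
  filter_upwards [hclose] with t ht
  have hint : ∀ {V : Ω t → ℝ}, AEMeasurable V (P t) → Integrable (fun ω => F (V ω)) (P t) := by
    intro V hV
    refine Integrable.of_bound (hFm.comp_aemeasurable hV).aestronglyMeasurable (|F 0| + C)
      (ae_of_all _ fun ω => ?_)
    have := hC (V ω) 0
    rw [Real.dist_eq] at this
    rw [Real.norm_eq_abs]
    linarith [abs_sub_abs_le_abs_sub (F (V ω)) (F 0)]
  have e1 : ∫ x, F x ∂((P t).map (T t)) = ∫ ω, F (T t ω) ∂(P t) :=
    integral_map (hT t) hFm.aestronglyMeasurable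
  have e2 : ∫ x, F x ∂(gaussianReal 0 1) = ∫ ω, F (W t ω) ∂(P t) := by
    rw [← hlaw t]
    exact integral_map (hW t) hFm.aestronglyMeasurable
  have e3 : ∫ ω, F (T t ω) ∂(P t) - ∫ ω, F (W t ω) ∂(P t)
      = ∫ ω, (F (T t ω) - F (W t ω)) ∂(P t) := (integral_sub (hint (hT t)) (hint (hW t))).symm
  rw [e1, e2, Real.dist_eq, e3]
  have hnull : NullMeasurableSet {ω | η t < |T t ω - W t ω|} (P t) :=
    nullMeasurableSet_lt aemeasurable_const ((hT t).sub (hW t)).abs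
  -- Off the exceptional event the Lipschitz constant `L` controls the difference; on it the
  -- oscillation bound `C` of the test function does.
  have hptw : ∀ ω, ‖F (T t ω) - F (W t ω)‖ ≤
      L * |η t| + ({ω | η t < |T t ω - W t ω|}.indicator (fun _ => C)) ω := by
    intro ω
    rw [← dist_eq_norm]
    by_cases h : η t < |T t ω - W t ω|
    · rw [Set.indicator_of_mem (by exact h)]
      have := hC (T t ω) (W t ω)
      have : 0 ≤ (L : ℝ) * |η t| := by positivity
      linarith
    · rw [Set.indicator_of_notMem (by exact h), add_zero]
      refine (hL.dist_le_mul _ _).trans ?_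
      rw [Real.dist_eq]
      exact mul_le_mul_of_nonneg_left ((not_lt.1 h).trans (le_abs_self _)) L.coe_nonneg
  have hiC : Integrable ({ω | η t < |T t ω - W t ω|}.indicator (fun _ => C)) (P t) :=
    (integrable_const C).indicator₀ hnull
  calc |∫ ω, (F (T t ω) - F (W t ω)) ∂(P t)|
      ≤ ∫ ω, ‖F (T t ω) - F (W t ω)‖ ∂(P t) := by
        rw [← Real.norm_eq_abs]; exact norm_integral_le_integral_norm _
    _ ≤ ∫ ω, (L * |η t| + ({ω | η t < |T t ω - W t ω|}.indicator (fun _ => C)) ω) ∂(P t) :=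
        integral_mono ((hint (hT t)).sub (hint (hW t))).norm
          ((integrable_const _).add hiC) hptw
    _ = L * |η t| + C * (P t).real {ω | η t < |T t ω - W t ω|} := by
        rw [integral_add (integrable_const _) hiC, integral_indicator₀ hnull]
        simp [mul_comm]
    _ ≤ _ := by gcongr

/-- By symmetry each tail has mass `α/2`. If `z ≤ 0`, then `1 - α/2 = P(x ≤ z) ≤ P(x ≤ -z) = α/2`,
contradicting `α < 1`; positivity of `z` makes the two tails disjoint. -/
lemma gaussianReal_abs_gt {α z : ℝ} (hα1 : α < 1)
    (hz : cdf (gaussianReal 0 1) z = 1 - α / 2) :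
    0 < z ∧ (gaussianReal 0 1).real {x | z < |x|} = α := by
  have h0 : NullSingletonClass (gaussianReal 0 1) := nullSingletonClass_gaussianReal one_ne_zero
  have hneg : ∀ c : ℝ, (gaussianReal 0 1).real (Set.Iio (-c)) = (gaussianReal 0 1).real (Set.Ioi c) := by
    intro c
    have h := gaussianReal_map_neg (μ := 0) (v := 1)
    rw [neg_zero] at h
    conv_lhs => rw [← h]
    rw [map_measureReal_apply measurable_neg measurableSet_Iio]
    congr 1; ext x; simp
  have hIoi : ∀ c : ℝ, (gaussianReal 0 1).real (Set.Ioi c) = 1 - cdf (gaussianReal 0 1) c := by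
    intro c
    rw [cdf_eq_real, ← Set.compl_Iic, measureReal_compl measurableSet_Iic]
    simp
  have hzpos : 0 < z := by
    by_contra hzn
    have h1 : (gaussianReal 0 1).real (Set.Iic z) ≤ (gaussianReal 0 1).real (Set.Iic (-z)) :=
      measureReal_mono (Set.Iic_subset_Iic.2 (by linarith))
    have h2 : (gaussianReal 0 1).real (Set.Iic (-z)) = (gaussianReal 0 1).real (Set.Iio (-z)) :=
      measureReal_congr Iio_ae_eq_Iic.symm
    rw [h2, hneg, hIoi, ← cdf_eq_real, hz] at h1
    linarith
  refine ⟨hzpos, ?_⟩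
  have hset : {x : ℝ | z < |x|} = Set.Iio (-z) ∪ Set.Ioi z := by
    ext x
    simp only [Set.mem_ofPred_eq, Set.mem_union, Set.mem_Iio, Set.mem_Ioi, lt_abs]
    constructor
    · rintro (h | h)
      · exact Or.inr h
      · left; linarith
    · rintro (h | h)
      · right; linarith
      · exact Or.inl h
  rw [hset, measureReal_union _ measurableSet_Ioi, hneg, hIoi, hz]
  · ring
  · rw [Set.disjoint_left]
    intro x hx hx'
    simp only [Set.mem_Iio, Set.mem_Ioi] at hx hx'
    linarith

/-- Two-sided tests based on asymptotically standard normal statistics have asymptotic level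
`α`. -/
lemma tendsto_measureReal_abs_gt {Ω : ℕ → Type*} [∀ t, MeasurableSpace (Ω t)]
    {P : ∀ t, Measure (Ω t)} [∀ t, IsProbabilityMeasure (P t)] {T : ∀ t, Ω t → ℝ}
    (hT : TendstoInDistribution T atTop (id : ℝ → ℝ) P (gaussianReal 0 1)) {α z : ℝ}
    (hα1 : α < 1) (hz : cdf (gaussianReal 0 1) z = 1 - α / 2) :
    Tendsto (fun t => (P t).real {ω | z < |T t ω|}) atTop (𝓝 α) := by
  obtain ⟨hzpos, hval⟩ := gaussianReal_abs_gt hα1 hz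
  have h0 : NullSingletonClass (gaussianReal 0 1) := nullSingletonClass_gaussianReal one_ne_zero
  have hopen : IsOpen {x : ℝ | z < |x|} := isOpen_lt continuous_const continuous_abs
  have hfront : (gaussianReal 0 1) (frontier {x : ℝ | z < |x|}) = 0 := by
    have hsub : frontier {x : ℝ | z < |x|} ⊆ {z, -z} := by
      intro x hx
      have h1 : z = |x| := frontier_lt_subset_eq continuous_const continuous_abs hx
      rcases eq_or_eq_neg_of_abs_eq h1.symm with h | h <;> simp [h]
    exact measure_mono_null hsub (Set.Finite.measure_zero (by simp) _)
  have h1 := ProbabilityMeasure.tendsto_measure_of_null_frontier_of_tendsto' hT.tendsto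
    (E := {x : ℝ | z < |x|}) (by simpa using hfront)
  simp only [ProbabilityMeasure.coe_mk, Measure.map_id] at h1
  have h2 := (ENNReal.tendsto_toReal (measure_ne_top _ _)).comp h1
  have h3 : (gaussianReal 0 1 {x : ℝ | z < |x|}).toReal = α := hval
  rw [h3] at h2
  refine h2.congr fun t => ?_
  simp only [Function.comp]
  rw [Measure.map_apply_of_aemeasurable (hT.forall_aemeasurable t) hopen.measurableSet]
  rfl

end Gaussian

/-! ### Elementary inequalities for vectors and matrices -/

section Algebra

lemma dotProduct_sq_le {ι : Type*} [Fintype ι] (a b : ι → ℝ) :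
    (a ⬝ᵥ b) ^ 2 ≤ (a ⬝ᵥ a) * (b ⬝ᵥ b) := by
  have := Finset.sum_mul_sq_le_sq_mul_sq Finset.univ a b
  simpa [dotProduct, sq] using this

lemma dotProduct_self_nonneg_real {ι : Type*} [Fintype ι] (a : ι → ℝ) : 0 ≤ a ⬝ᵥ a :=
  Finset.sum_nonneg fun i _ => mul_self_nonneg (a i)

lemma abs_sqrt_sub_sqrt_le {ι : Type*} [Fintype ι] (a b : ι → ℝ) :
    |√((a - b) ⬝ᵥ (a - b)) - √(a ⬝ᵥ a)| ≤ √(b ⬝ᵥ b) := by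
  have e : ∀ v : ι → ℝ, √(v ⬝ᵥ v) = ‖WithLp.toLp 2 v‖ := by
    intro v
    rw [EuclideanSpace.norm_eq]
    simp [dotProduct, sq]
  rw [e, e, e]
  have h := abs_norm_sub_norm_le (WithLp.toLp 2 (a - b)) (WithLp.toLp 2 a)
  rw [← WithLp.toLp_sub] at h
  have e2 : a - b - a = -b := by abel
  rwa [e2, WithLp.toLp_neg, norm_neg] at h

/-- Hölder's inequality in both arguments. It turns entrywise bounds into the restricted eigenvalue
bound, the variance bound and the bias bound. -/
lemma abs_dotProduct_mulVec_le {ι κ : Type*} [Fintype ι] [Fintype κ] {A : Matrix ι κ ℝ} {η : ℝ}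
    (hA : ∀ i j, |A i j| ≤ η) (f : ι → ℝ) (h : κ → ℝ) :
    |f ⬝ᵥ (A *ᵥ h)| ≤ η * (∑ i, |f i|) * ∑ j, |h j| := by
  have h1 : ∀ i, |(A *ᵥ h) i| ≤ η * ∑ j, |h j| := by
    intro i
    rw [mulVec, dotProduct, Finset.mul_sum]
    refine (Finset.abs_sum_le_sum_abs _ _).trans (Finset.sum_le_sum fun j _ => ?_)
    rw [abs_mul]
    exact mul_le_mul_of_nonneg_right (hA i j) (abs_nonneg _)
  calc |f ⬝ᵥ (A *ᵥ h)| ≤ ∑ i, |f i * (A *ᵥ h) i| := Finset.abs_sum_le_sum_abs _ _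
    _ ≤ ∑ i, |f i| * (η * ∑ j, |h j|) := by
        refine Finset.sum_le_sum fun i _ => ?_
        rw [abs_mul]
        exact mul_le_mul_of_nonneg_left (h1 i) (abs_nonneg _)
    _ = _ := by rw [← Finset.sum_mul]; ring

lemma mulVec_transpose_dotProduct {ι κ : Type*} [Fintype ι] [Fintype κ] (A : Matrix ι κ ℝ)
    (u : ι → ℝ) (v : κ → ℝ) : (Aᵀ *ᵥ u) ⬝ᵥ v = u ⬝ᵥ (A *ᵥ v) := by
  rw [mulVec_transpose, dotProduct_mulVec]

end Algebra

/-! ### Norm bounds for the graph difference operators -/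

section Operators

variable {n : ℕ} (G : SimpleGraph (Fin n))

lemma incidence_dotProduct (e : Edge G) (h : Fin n → ℝ) :
    incidence G e ⬝ᵥ h = h e.1.2 - h e.1.1 := by
  have hne : e.1.1 ≠ e.1.2 := e.2.1.ne
  have h1 : ∀ v, incidence G e v * h v
      = (if v = e.1.2 then h v else 0) - (if v = e.1.1 then h v else 0) := by
    intro v
    simp only [incidence, Matrix.of_apply]
    by_cases h1 : v = e.1.1
    · have h2 : v ≠ e.1.2 := h1 ▸ hne
      simp [h1, hne]
    · simp [h1]
  simp only [dotProduct, h1, Finset.sum_sub_distrib]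
  simp

lemma sum_abs_incidence (e : Edge G) : ∑ v, |incidence G e v| = 2 := by
  have hne : e.1.1 ≠ e.1.2 := e.2.1.ne
  have h1 : ∀ v, |incidence G e v|
      = (if v = e.1.2 then 1 else 0) + (if v = e.1.1 then 1 else 0) := by
    intro v
    simp only [incidence, Matrix.of_apply]
    by_cases h1 : v = e.1.1
    · simp [h1, hne]
    · by_cases h2 : v = e.1.2
      · simp [h2, hne.symm]
      · simp [h1, h2]
  simp only [h1, Finset.sum_add_distrib]
  simp
  norm_num

lemma incidence_dotProduct_self (e : Edge G) : incidence G e ⬝ᵥ incidence G e = 2 := by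
  have hne : e.1.2 ≠ e.1.1 := e.2.1.ne'
  rw [incidence_dotProduct]
  simp [incidence, hne]
  norm_num

variable [DecidableRel G.Adj]

/-- Each edge contributes `(h v - h u)² ≤ 2 (h u² + h v²)`, and each vertex is counted as often as
its degree. -/
lemma incidence_mulVec_sq_le (h : Fin n → ℝ) :
    (incidence G *ᵥ h) ⬝ᵥ (incidence G *ᵥ h) ≤ 2 * G.maxDegree * (h ⬝ᵥ h) := by
  have h1 : (incidence G *ᵥ h) ⬝ᵥ (incidence G *ᵥ h)
      ≤ ∑ e : Edge G, 2 * (h e.1.1 ^ 2 + h e.1.2 ^ 2) := by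
    refine Finset.sum_le_sum fun e _ => ?_
    have : (incidence G *ᵥ h) e = h e.1.2 - h e.1.1 := incidence_dotProduct G e h
    rw [this]
    nlinarith [sq_nonneg (h e.1.2 + h e.1.1)]
  have h2 : ∑ e : Edge G, 2 * (h e.1.1 ^ 2 + h e.1.2 ^ 2)
      = ∑ u, ∑ v, if u < v ∧ G.Adj u v then 2 * (h u ^ 2 + h v ^ 2) else 0 := by
    rw [← Fintype.sum_prod_type' (f := fun u v => if u < v ∧ G.Adj u v then
      2 * (h u ^ 2 + h v ^ 2) else 0), ← Finset.sum_filter]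
    symm
    refine Finset.sum_subtype _ (fun x => ?_) (fun x : Fin n × Fin n => 2 * (h x.1 ^ 2 + h x.2 ^ 2))
    simp
  have h3 : ∑ u, ∑ v, (if u < v ∧ G.Adj u v then 2 * (h u ^ 2 + h v ^ 2) else 0)
      = ∑ u, ∑ v, ((if u < v ∧ G.Adj u v then 2 * h u ^ 2 else 0)
        + (if v < u ∧ G.Adj u v then 2 * h u ^ 2 else 0)) := by
    have h4 : ∑ u, ∑ v, (if u < v ∧ G.Adj u v then 2 * h v ^ 2 else 0)
        = ∑ u, ∑ v, (if v < u ∧ G.Adj u v then 2 * h u ^ 2 else 0) := by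
      rw [Finset.sum_comm]
      simp_rw [G.adj_comm]
    simp_rw [Finset.sum_add_distrib]
    rw [← h4]
    simp_rw [← Finset.sum_add_distrib]
    refine Finset.sum_congr rfl fun u _ => Finset.sum_congr rfl fun v _ => ?_
    split_ifs <;> ring
  have h5 : ∀ u, ∑ v, ((if u < v ∧ G.Adj u v then 2 * h u ^ 2 else 0)
        + (if v < u ∧ G.Adj u v then 2 * h u ^ 2 else 0)) ≤ 2 * G.maxDegree * (h u * h u) := by
    intro u
    have h6 : ∀ v, ((if u < v ∧ G.Adj u v then 2 * h u ^ 2 else 0)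
        + (if v < u ∧ G.Adj u v then 2 * h u ^ 2 else 0))
        ≤ if G.Adj u v then 2 * h u ^ 2 else 0 := by
      intro v
      have hp : 0 ≤ 2 * h u ^ 2 := by positivity
      by_cases ha : G.Adj u v
      · rcases lt_trichotomy u v with hl | hl | hl
        · simp [ha, hl, hl.not_gt]
        · exact absurd hl ha.ne
        · simp [ha, hl, hl.not_gt]
      · simp [ha]
    refine (Finset.sum_le_sum fun v _ => h6 v).trans ?_
    rw [← Finset.sum_filter, Finset.sum_const, ← G.neighborFinset_eq_filter,
      G.card_neighborFinset_eq_degree, nsmul_eq_mul]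
    have h7 : (G.degree u : ℝ) ≤ G.maxDegree := by exact_mod_cast G.degree_le_maxDegree u
    nlinarith [mul_le_mul_of_nonneg_right h7 (sq_nonneg (h u))]
  refine h1.trans ?_
  rw [h2, h3, dotProduct, Finset.mul_sum]
  exact Finset.sum_le_sum fun u _ => h5 u

/-- With `w = L h`, `|w|² = ⟨F h, F w⟩`. Cauchy–Schwarz and two uses of the bound for `F` give `|w|⁴
≤ (2d)² |h|² |w|²`, so the transpose of `F` needs no bound of its own. -/
lemma laplacian_mulVec_sq_le (h : Fin n → ℝ) :
    (laplacian G *ᵥ h) ⬝ᵥ (laplacian G *ᵥ h) ≤ (2 * G.maxDegree) ^ 2 * (h ⬝ᵥ h) := by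
  set g := incidence G *ᵥ h with hg
  set w := laplacian G *ᵥ h with hw
  have h1 : w = (incidence G)ᵀ *ᵥ g := by rw [hw, hg, laplacian, mulVec_mulVec]
  have h2 : w ⬝ᵥ w = g ⬝ᵥ (incidence G *ᵥ w) := by
    conv_lhs => rw [h1]
    rw [mulVec_transpose_dotProduct, ← h1]
  have h3 := dotProduct_sq_le g (incidence G *ᵥ w)
  rw [← h2] at h3
  have h4 := incidence_mulVec_sq_le G w
  have h5 := incidence_mulVec_sq_le G h
  rw [← hg] at h5
  have hd : (0 : ℝ) ≤ 2 * G.maxDegree := by positivity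
  have h6 := dotProduct_self_nonneg_real w
  have h7 := dotProduct_self_nonneg_real g
  have h8 := dotProduct_self_nonneg_real h
  have h9 : (w ⬝ᵥ w) ^ 2 ≤ (2 * G.maxDegree) ^ 2 * (h ⬝ᵥ h) * (w ⬝ᵥ w) := by
    calc _ ≤ (g ⬝ᵥ g) * ((incidence G *ᵥ w) ⬝ᵥ (incidence G *ᵥ w)) := h3
      _ ≤ (2 * G.maxDegree * (h ⬝ᵥ h)) * (2 * G.maxDegree * (w ⬝ᵥ w)) :=
        mul_le_mul h5 h4 (dotProduct_self_nonneg_real _) (by positivity)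
      _ = _ := by ring
  rcases h6.eq_or_lt with h0 | h0
  · rw [← h0]; positivity
  · rw [sq] at h9
    exact le_of_mul_le_mul_right h9 h0

lemma graphDiff_mulVec_sq_le : ∀ (k : ℕ) (h : Fin n → ℝ),
    (graphDiff G k *ᵥ h) ⬝ᵥ (graphDiff G k *ᵥ h) ≤ (2 * G.maxDegree) ^ (k + 1) * (h ⬝ᵥ h)
  | 0, h => by
      have := incidence_mulVec_sq_le G h
      rw [zero_add, pow_one]
      exact this
  | 1, h => laplacian_mulVec_sq_le G h
  | k + 2, h => by
      have h1 := graphDiff_mulVec_sq_le k (laplacian G *ᵥ h)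
      rw [mulVec_mulVec] at h1
      have h2 := laplacian_mulVec_sq_le G h
      have hd : (0 : ℝ) ≤ 2 * G.maxDegree := by positivity
      refine (show (graphDiff G (k + 2) *ᵥ h) ⬝ᵥ (graphDiff G (k + 2) *ᵥ h) ≤ _ from h1).trans ?_
      calc _ ≤ (2 * (G.maxDegree : ℝ)) ^ (k + 1) * ((2 * G.maxDegree) ^ 2 * (h ⬝ᵥ h)) := by gcongr
        _ = _ := by ring

end Operators

/-! ### Quadratic forms and inverse of the covariance matrix -/

section Spectral

variable {n : ℕ} {S : Matrix (Fin n) (Fin n) ℝ} {c₁ c₂ : ℝ}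

lemma dotProduct_mulVec_mem_Icc (hS : S.IsHermitian) (hspec : spectrum ℝ S ⊆ Set.Icc c₁ c₂)
    (h : Fin n → ℝ) : c₁ * (h ⬝ᵥ h) ≤ h ⬝ᵥ (S *ᵥ h) ∧ h ⬝ᵥ (S *ᵥ h) ≤ c₂ * (h ⬝ᵥ h) := by
  have hone : ∀ c : ℝ, (algebraMap ℝ (Matrix (Fin n) (Fin n) ℝ) c).IsHermitian := by
    intro c
    rw [Algebra.algebraMap_eq_smul_one]
    exact isHermitian_one.smul (by simp [IsSelfAdjoint])
  have hmul : ∀ c : ℝ, h ⬝ᵥ ((algebraMap ℝ (Matrix (Fin n) (Fin n) ℝ) c) *ᵥ h) = c * (h ⬝ᵥ h) := by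
    intro c
    rw [Algebra.algebraMap_eq_smul_one, smul_mulVec, one_mulVec, dotProduct_smul, smul_eq_mul]
  constructor
  · have hp : (S - algebraMap ℝ _ c₁).PosSemidef := by
      rw [posSemidef_iff_isHermitian_and_spectrum_nonneg]
      refine ⟨hS.sub (hone c₁), ?_⟩
      rw [← spectrum.sub_singleton_eq]
      rintro _ ⟨x, hx, y, hy, rfl⟩
      rw [Set.mem_singleton_iff.1 hy]
      exact sub_nonneg.2 (hspec hx).1
    have := hp.dotProduct_mulVec_nonneg h
    simp only [star_trivial, sub_mulVec, dotProduct_sub, hmul] at this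
    linarith
  · have hp : (algebraMap ℝ _ c₂ - S).PosSemidef := by
      rw [posSemidef_iff_isHermitian_and_spectrum_nonneg]
      refine ⟨(hone c₂).sub hS, ?_⟩
      rw [← spectrum.singleton_sub_eq]
      rintro _ ⟨y, hy, x, hx, rfl⟩
      rw [Set.mem_singleton_iff.1 hy]
      exact sub_nonneg.2 (hspec hx).2
    have := hp.dotProduct_mulVec_nonneg h
    simp only [star_trivial, sub_mulVec, dotProduct_sub, hmul] at this
    linarith

lemma inv_mul_of_spectrum (hc₁ : 0 < c₁) (hspec : spectrum ℝ S ⊆ Set.Icc c₁ c₂) :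
    S⁻¹ * S = 1 := by
  have h0 : (0 : ℝ) ∉ spectrum ℝ S := fun h => (hspec h).1.not_gt hc₁
  have hu : IsUnit S := spectrum.zero_notMem_iff ℝ |>.1 h0
  exact nonsing_inv_mul S ((isUnit_iff_isUnit_det S).1 hu)

/-- The row `w` satisfies `wᵀ S = e_aᵀ`, hence `c₁ |w|² ≤ wᵀ S w = w a ≤ |w|`. This makes the
projections of the design on the rows of `S⁻¹` sub-Gaussian with parameter `σx / c₁`. -/
lemma inv_row_dotProduct_self_le (hc₁ : 0 < c₁) (hS : S.IsHermitian)
    (hspec : spectrum ℝ S ⊆ Set.Icc c₁ c₂) (a : Fin n) : S⁻¹ a ⬝ᵥ S⁻¹ a ≤ (1 / c₁) ^ 2 := by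
  set w := S⁻¹ a with hw
  have h1 : w ᵥ* S = Pi.single a 1 := by
    have h2 := congrFun (inv_mul_of_spectrum hc₁ hspec) a
    have h3 : (S⁻¹ * S) a = w ᵥ* S := rfl
    rw [← h3, h2]
    ext b
    rw [one_apply, Pi.single_apply]
    simp [eq_comm]
  have h2 : w ⬝ᵥ (S *ᵥ w) = w a := by
    rw [dotProduct_mulVec, h1, single_dotProduct, one_mul]
  have h3 := (dotProduct_mulVec_mem_Icc hS hspec w).1
  rw [h2] at h3
  have h4 : w a * w a ≤ w ⬝ᵥ w :=
    Finset.single_le_sum (f := fun i => w i * w i) (fun i _ => mul_self_nonneg _) (Finset.mem_univ a)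
  have h5 := dotProduct_self_nonneg_real w
  have h6 : (c₁ * (w ⬝ᵥ w)) * (c₁ * (w ⬝ᵥ w)) ≤ w ⬝ᵥ w :=
    (mul_self_le_mul_self (by positivity) h3).trans h4
  rw [div_pow, one_pow, le_div_iff₀ (by positivity)]
  by_contra hcon
  push Not at hcon
  have : 0 < w ⬝ᵥ w := by
    rcases h5.eq_or_lt with h | h
    · rw [← h] at hcon; linarith
    · exact h
  nlinarith

end Spectral

/-! ### Error bounds for the graph lasso -/

section Lasso

/-- `A` is the `ℓ₁`-norm of `b - a` on the support of `a`, bounded by Cauchy–Schwarz. The cruder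
estimate serves the graph penalty; the one that keeps `-‖b - a‖₁` serves the sparsity penalty and
yields the cone condition. -/
lemma exists_l1_decomposition {R : Type*} [Fintype R] (a b : R → ℝ) {s : ℕ}
    (hs : hammingNorm a ≤ s) :
    ∃ A : ℝ, A ≤ √s * √((b - a) ⬝ᵥ (b - a)) ∧ ∑ r, |a r| - ∑ r, |b r| ≤ A ∧
      ∑ r, |a r| - ∑ r, |b r| ≤ 2 * A - ∑ r, |(b - a) r| := by
  classical
  set S := Finset.univ.filter fun r => a r ≠ 0 with hS
  have hcard : (S.card : ℝ) ≤ s := by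
    have : S.card ≤ s := by simpa [hammingNorm, hS] using hs
    exact_mod_cast this
  refine ⟨∑ r ∈ S, |(b - a) r|, ?_, ?_, ?_⟩
  · rw [← Real.sqrt_mul (by positivity)]
    apply Real.le_sqrt_of_sq_le
    have h1 := sq_sum_le_card_mul_sum_sq (s := S) (f := fun r => |(b - a) r|)
    have h2 : ∑ r ∈ S, |(b - a) r| ^ 2 ≤ (b - a) ⬝ᵥ (b - a) := by
      simp only [sq_abs, dotProduct, ← sq]
      exact Finset.sum_le_sum_of_subset_of_nonneg (Finset.subset_univ _) fun i _ _ => sq_nonneg _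
    calc _ ≤ _ := h1
      _ ≤ _ := by gcongr
  · rw [← Finset.sum_sub_distrib, hS, Finset.sum_filter]
    refine Finset.sum_le_sum fun r _ => ?_
    split_ifs with h
    · rw [Pi.sub_apply, abs_sub_comm]
      exact abs_sub_abs_le_abs_sub _ _
    · rw [not_not.1 h]; simp
  · rw [← Finset.sum_sub_distrib, hS, Finset.sum_filter, Finset.mul_sum, ← Finset.sum_sub_distrib]
    refine Finset.sum_le_sum fun r _ => ?_
    split_ifs with h
    · rw [Pi.sub_apply, abs_sub_comm (b r)]
      linarith [abs_sub_abs_le_abs_sub (a r) (b r)]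
    · rw [Pi.sub_apply, not_not.1 h]; simp

variable {N n : ℕ}

lemma dotProduct_sampleCov_mulVec (X : Matrix (Fin N) (Fin n) ℝ) (u v : Fin n → ℝ) :
    u ⬝ᵥ (sampleCov X *ᵥ v) = 1 / N * ((X *ᵥ u) ⬝ᵥ (X *ᵥ v)) := by
  rw [sampleCov, smul_mulVec, dotProduct_smul, smul_eq_mul, ← mulVec_mulVec,
    ← mulVec_transpose_dotProduct, transpose_transpose]

/-- The basic inequality of the graph lasso, with the graph penalty absorbed into the `ℓ₂`-norm of
the estimation error. -/
lemma IsGraphLasso.basic_inequality (G : SimpleGraph (Fin n)) [DecidableRel G.Adj] {k s₁ s₂ : ℕ}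
    {ν lam : ℝ} (hN : 0 < N) (hd : 0 < G.maxDegree) (hν : 0 ≤ ν) (hlam : 0 < lam) (hs₁ : 0 < s₁)
    (hs : ν ≤ (s₂ : ℝ) / s₁) {X : Matrix (Fin N) (Fin n) ℝ} {ε : Fin N → ℝ}
    {βs βhat : Fin n → ℝ} (hβs : βs ∈ paramSpace G k s₁ s₂)
    (hmin : IsGraphLasso G k (lam * √(ν / (2 * (G.maxDegree : ℝ)) ^ (k + 1))) lam X
      (X *ᵥ βs + ε) βhat)
    (hnoise : ∀ a, |1 / (N : ℝ) * (Xᵀ *ᵥ ε) a| ≤ lam / 2) :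
    1 / (N : ℝ) * ((X *ᵥ (βhat - βs)) ⬝ᵥ (X *ᵥ (βhat - βs))) + lam * ∑ a, |(βhat - βs) a|
      ≤ 6 * lam * √s₂ * √((βhat - βs) ⬝ᵥ (βhat - βs)) := by
  set h := βhat - βs with hh
  obtain ⟨A₁, hA₁, hA₁', -⟩ := exists_l1_decomposition (graphDiff G k *ᵥ βs)
    (graphDiff G k *ᵥ βhat) hβs.1
  obtain ⟨A₂, hA₂, -, hA₂'⟩ := exists_l1_decomposition βs βhat hβs.2
  rw [← mulVec_sub, ← hh] at hA₁
  rw [← hh] at hA₂ hA₂'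
  have hN' : (0 : ℝ) < N := by exact_mod_cast hN
  have hD : (0 : ℝ) < (2 * (G.maxDegree : ℝ)) ^ (k + 1) := by
    have : (0 : ℝ) < G.maxDegree := by exact_mod_cast hd
    positivity
  -- The scale `(2d)^(-(k+1)/2)` in the graph penalty cancels the operator norm, leaving `√(ν s₁) ≤
  -- √s₂`.
  have hA₁b : lam * √(ν / (2 * (G.maxDegree : ℝ)) ^ (k + 1)) * A₁ ≤ lam * √s₂ * √(h ⬝ᵥ h) := by
    have h1 : √((graphDiff G k *ᵥ h) ⬝ᵥ (graphDiff G k *ᵥ h))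
        ≤ √((2 * (G.maxDegree : ℝ)) ^ (k + 1)) * √(h ⬝ᵥ h) := by
      rw [← Real.sqrt_mul hD.le]
      exact Real.sqrt_le_sqrt (graphDiff_mulVec_sq_le G k h)
    have h2 : √(ν / (2 * (G.maxDegree : ℝ)) ^ (k + 1)) * √((2 * (G.maxDegree : ℝ)) ^ (k + 1))
        = √ν := by
      rw [← Real.sqrt_mul (by positivity), div_mul_cancel₀ _ hD.ne']
    have h3 : √ν * √(s₁ : ℝ) ≤ √(s₂ : ℝ) := by
      rw [← Real.sqrt_mul hν]
      apply Real.sqrt_le_sqrt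
      rwa [le_div_iff₀ (by exact_mod_cast hs₁)] at hs
    calc _ ≤ lam * √(ν / (2 * (G.maxDegree : ℝ)) ^ (k + 1)) *
          (√s₁ * (√((2 * (G.maxDegree : ℝ)) ^ (k + 1)) * √(h ⬝ᵥ h))) := by
          refine mul_le_mul_of_nonneg_left (hA₁.trans ?_) (by positivity)
          gcongr
      _ = lam * (√(ν / (2 * (G.maxDegree : ℝ)) ^ (k + 1)) * √((2 * (G.maxDegree : ℝ)) ^ (k + 1))
          * √s₁) * √(h ⬝ᵥ h) := by ring
      _ ≤ _ := by rw [h2]; gcongr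
  have hm := hmin βs
  simp only [objective] at hm
  have e1 : ∀ i, (X *ᵥ βs + ε) i - (X *ᵥ βhat) i = ε i - (X *ᵥ h) i := by
    intro i
    rw [hh, mulVec_sub]; simp only [Pi.add_apply, Pi.sub_apply]; ring
  have e2 : ∀ i, (X *ᵥ βs + ε) i - (X *ᵥ βs) i = ε i := by
    intro i; simp
  simp_rw [e1, e2] at hm
  have e3 : ∑ i, (ε i - (X *ᵥ h) i) ^ 2
      = ∑ i, ε i ^ 2 - 2 * (ε ⬝ᵥ (X *ᵥ h)) + (X *ᵥ h) ⬝ᵥ (X *ᵥ h) := by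
    simp only [dotProduct, Finset.mul_sum]
    rw [← Finset.sum_sub_distrib, ← Finset.sum_add_distrib]
    exact Finset.sum_congr rfl fun i _ => by ring
  rw [e3] at hm
  have hcross : 1 / (N : ℝ) * (ε ⬝ᵥ (X *ᵥ h)) ≤ lam / 2 * ∑ a, |h a| := by
    rw [← mulVec_transpose_dotProduct, dotProduct, Finset.mul_sum, Finset.mul_sum]
    refine Finset.sum_le_sum fun a _ => ?_
    rw [← mul_assoc]
    calc _ ≤ |1 / (N : ℝ) * (Xᵀ *ᵥ ε) a * h a| := le_abs_self _
      _ = |1 / (N : ℝ) * (Xᵀ *ᵥ ε) a| * |h a| := abs_mul _ _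
      _ ≤ _ := mul_le_mul_of_nonneg_right (hnoise a) (abs_nonneg _)
  have e4 : 1 / (2 * (N : ℝ)) * (∑ i, ε i ^ 2 - 2 * (ε ⬝ᵥ (X *ᵥ h)) + (X *ᵥ h) ⬝ᵥ (X *ᵥ h))
      = 1 / (2 * (N : ℝ)) * ∑ i, ε i ^ 2 - 1 / (N : ℝ) * (ε ⬝ᵥ (X *ᵥ h))
        + 1 / 2 * (1 / (N : ℝ) * ((X *ᵥ h) ⬝ᵥ (X *ᵥ h))) := by
    field_simp
  rw [e4] at hm
  have hg := mul_le_mul_of_nonneg_left hA₁' (by positivity :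
    0 ≤ lam * √(ν / (2 * (G.maxDegree : ℝ)) ^ (k + 1)))
  have hl := mul_le_mul_of_nonneg_left hA₂' hlam.le
  have hl2 := mul_le_mul_of_nonneg_left hA₂ hlam.le
  -- With `Q = |X h|²/N` and `l = ‖h‖₁`: `Q/2 ≤ λl/2 + λ√s₂‖h‖₂ + 2λ√s₂‖h‖₂ - λl`. Doubling gives
  -- the factor `6`.
  linarith

/-- Estimation and prediction error of the graph lasso under a restricted eigenvalue bound. -/
lemma error_bounds_of_basic_inequality {S : Matrix (Fin n) (Fin n) ℝ} {X : Matrix (Fin N) (Fin n) ℝ}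
    {h : Fin n → ℝ} {lam c₁ η : ℝ} {s₂ : ℕ} (hlam : 0 < lam) (hc₁ : 0 < c₁)
    (hS : c₁ * (h ⬝ᵥ h) ≤ h ⬝ᵥ (S *ᵥ h)) (hη : ∀ a b, |(sampleCov X - S) a b| ≤ η)
    (hη0 : 0 ≤ η) (hsmall : 36 * s₂ * η ≤ c₁ / 2)
    (hb : 1 / (N : ℝ) * ((X *ᵥ h) ⬝ᵥ (X *ᵥ h)) + lam * ∑ a, |h a| ≤ 6 * lam * √s₂ * √(h ⬝ᵥ h)) :
    ∑ a, |h a| ≤ 72 * lam * s₂ / c₁ ∧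
      1 / (N : ℝ) * ((X *ᵥ h) ⬝ᵥ (X *ᵥ h)) ≤ 72 * lam ^ 2 * s₂ / c₁ := by
  set Q := 1 / (N : ℝ) * ((X *ᵥ h) ⬝ᵥ (X *ᵥ h)) with hQ
  set q := √(h ⬝ᵥ h) with hq
  set l := ∑ a, |h a| with hl
  have hq0 : 0 ≤ q := Real.sqrt_nonneg _
  have hqq : h ⬝ᵥ h = q ^ 2 := (Real.sq_sqrt (dotProduct_self_nonneg_real h)).symm
  have hs0 : 0 ≤ √(s₂ : ℝ) := Real.sqrt_nonneg _
  have hss : √(s₂ : ℝ) ^ 2 = s₂ := Real.sq_sqrt (by positivity)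
  have hQ0 : 0 ≤ Q := mul_nonneg (by positivity) (dotProduct_self_nonneg_real _)
  have hl0 : 0 ≤ l := Finset.sum_nonneg fun a _ => abs_nonneg _
  have hcone : l ≤ 6 * √s₂ * q := by
    have : lam * l ≤ lam * (6 * √s₂ * q) := by linarith
    exact le_of_mul_le_mul_left this hlam
  -- Replacing `S` by the sample covariance costs at most `η l²`, and the cone condition gives `η l²
  -- ≤ 36 s₂ η q² ≤ (c₁/2) q²`.
  have hre : c₁ / 2 * q ^ 2 ≤ Q := by
    have h1 := abs_dotProduct_mulVec_le hη h h
    rw [sub_mulVec, dotProduct_sub, dotProduct_sampleCov_mulVec, ← hQ, ← hl] at h1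
    have h2 := (abs_le.1 h1).1
    rw [hqq] at hS
    have h3 : l * l ≤ (6 * √s₂ * q) * (6 * √s₂ * q) := mul_self_le_mul_self hl0 hcone
    have h4 : (6 * √s₂ * q) * (6 * √s₂ * q) = 36 * s₂ * q ^ 2 := by
      linear_combination 36 * q ^ 2 * hss
    have h5 := mul_le_mul_of_nonneg_left h3 hη0
    rw [h4] at h5
    have h6 := mul_le_mul_of_nonneg_right hsmall (sq_nonneg q)
    linarith
  have hQle : Q ≤ 6 * lam * √s₂ * q := by
    have : 0 ≤ lam * l := by positivity
    linarith
  have hqle : q ≤ 12 * lam * √s₂ / c₁ := by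
    rw [le_div_iff₀ hc₁]
    rcases hq0.eq_or_lt with h0 | h0
    · rw [← h0]; simp; positivity
    · have : c₁ / 2 * q * q ≤ 6 * lam * √s₂ * q := by nlinarith
      have := le_of_mul_le_mul_right this h0
      linarith
  constructor
  · calc l ≤ 6 * √s₂ * q := hcone
      _ ≤ 6 * √s₂ * (12 * lam * √s₂ / c₁) := by gcongr
      _ = 72 * lam * √s₂ ^ 2 / c₁ := by ring
      _ = _ := by rw [hss]
  · calc Q ≤ 6 * lam * √s₂ * q := hQle
      _ ≤ 6 * lam * √s₂ * (12 * lam * √s₂ / c₁) := by gcongr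
      _ = 72 * lam ^ 2 * √s₂ ^ 2 / c₁ := by ring
      _ = _ := by rw [hss]

end Lasso

/-! ### The one-step estimator, its variance and the noise level estimate -/

section Debiasing

variable {N n : ℕ}

lemma dotProduct_oneStep_sub {X : Matrix (Fin N) (Fin n) ℝ} {ε : Fin N → ℝ} {βs βhat : Fin n → ℝ}
    (Θ : Matrix (Fin n) (Fin n) ℝ) (f : Fin n → ℝ) :
    f ⬝ᵥ oneStep X (X *ᵥ βs + ε) βhat Θ - f ⬝ᵥ βs
      = 1 / N * ((X *ᵥ (Θᵀ *ᵥ f)) ⬝ᵥ ε) - f ⬝ᵥ ((Θ * sampleCov X - 1) *ᵥ (βhat - βs)) := by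
  have h1 : X *ᵥ βs + ε - X *ᵥ βhat = ε - X *ᵥ (βhat - βs) := by rw [mulVec_sub]; abel
  have h2 : (X *ᵥ (Θᵀ *ᵥ f)) ⬝ᵥ ε = f ⬝ᵥ ((Θ * Xᵀ) *ᵥ ε) := by
    rw [← mulVec_mulVec, ← mulVec_transpose_dotProduct, ← mulVec_transpose_dotProduct,
      transpose_transpose]
  have h3 : (Θ * sampleCov X) *ᵥ (βhat - βs)
      = (1 / (N : ℝ)) • ((Θ * Xᵀ) *ᵥ (X *ᵥ (βhat - βs))) := by
    rw [sampleCov, mul_smul_comm, smul_mulVec, mulVec_mulVec, Matrix.mul_assoc]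
  rw [oneStep, h1, h2, sub_mulVec, one_mulVec, h3, mulVec_sub _ ε]
  simp only [dotProduct_add, dotProduct_sub, dotProduct_smul, smul_eq_mul, smul_sub]
  ring

/-- The vector whose length gives the variance is the one that multiplies `ε` in
`dotProduct_oneStep_sub`, so studentising leaves a unit direction. -/
lemma dotProduct_sandwich_mulVec (X : Matrix (Fin N) (Fin n) ℝ) (Θ : Matrix (Fin n) (Fin n) ℝ)
    (f : Fin n → ℝ) : f ⬝ᵥ ((Θ * sampleCov X * Θᵀ) *ᵥ f)
      = 1 / N * ((X *ᵥ (Θᵀ *ᵥ f)) ⬝ᵥ (X *ᵥ (Θᵀ *ᵥ f))) := by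
  rw [← dotProduct_sampleCov_mulVec, mulVec_transpose_dotProduct, mulVec_mulVec, mulVec_mulVec,
    Matrix.mul_assoc]

/-- The asymptotic variance of the one-step estimate along an edge is bounded below. -/
lemma sandwich_variance_ge (G : SimpleGraph (Fin n)) (e : Edge G)
    {X : Matrix (Fin N) (Fin n) ℝ} {S Θ : Matrix (Fin n) (Fin n) ℝ} {c₂ η μ : ℝ} (hc₂ : 0 < c₂)
    (hS : incidence G e ⬝ᵥ (S *ᵥ incidence G e) ≤ c₂ * (incidence G e ⬝ᵥ incidence G e))
    (hη : ∀ a b, |(sampleCov X - S) a b| ≤ η) (hηc : 2 * η ≤ c₂) (hΘ : CLIMEFeasible (sampleCov X) μ Θ)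
    (hμ : 4 * μ ≤ 1) :
    1 / (4 * c₂) ≤ 1 / N * ((X *ᵥ (Θᵀ *ᵥ incidence G e)) ⬝ᵥ (X *ᵥ (Θᵀ *ᵥ incidence G e))) := by
  set f := incidence G e with hf
  set q := X *ᵥ (Θᵀ *ᵥ f) with hq
  set x := X *ᵥ f with hx
  have hff : f ⬝ᵥ f = 2 := incidence_dotProduct_self G e
  have h1 := abs_dotProduct_mulVec_le hη f f
  have h2 := abs_dotProduct_mulVec_le hΘ f f
  rw [sum_abs_incidence] at h1 h2
  rw [sub_mulVec, dotProduct_sub] at h1 h2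
  rw [dotProduct_sampleCov_mulVec, ← hx] at h1
  rw [← mulVec_mulVec, ← mulVec_transpose_dotProduct, one_mulVec, dotProduct_sampleCov_mulVec,
    ← hq, ← hx, hff] at h2
  rw [hff] at hS
  -- Since `|f|² = 2` and `‖f‖₁² = 4`, the form `fᵀ Σ_N f` is at most `2c₂ + 4η ≤ 4c₂`, while `fᵀ Θ
  -- Σ_N f ≥ 2 - 4μ ≥ 1`. Cauchy–Schwarz between `q` and `x` then bounds the variance from below.
  have h3 : 1 / (N : ℝ) * (x ⬝ᵥ x) ≤ 4 * c₂ := by linarith [(abs_le.1 h1).2]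
  have h4 : 1 ≤ 1 / (N : ℝ) * (q ⬝ᵥ x) := by linarith [(abs_le.1 h2).1]
  have h5 := dotProduct_sq_le q x
  set A := 1 / (N : ℝ) * (q ⬝ᵥ q) with hA
  have hA0 : 0 ≤ A := mul_nonneg (by positivity) (dotProduct_self_nonneg_real _)
  have h6 : (1 / (N : ℝ) * (q ⬝ᵥ x)) ^ 2 ≤ A * (1 / (N : ℝ) * (x ⬝ᵥ x)) := by
    calc _ = (1 / (N : ℝ)) ^ 2 * (q ⬝ᵥ x) ^ 2 := by ring
      _ ≤ (1 / (N : ℝ)) ^ 2 * ((q ⬝ᵥ q) * (x ⬝ᵥ x)) := by gcongr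
      _ = _ := by rw [hA]; ring
  have h7 : 1 ≤ A * (4 * c₂) := by
    calc (1 : ℝ) ≤ (1 / (N : ℝ) * (q ⬝ᵥ x)) ^ 2 := one_le_pow₀ h4
      _ ≤ _ := h6
      _ ≤ _ := by gcongr
  rwa [div_le_iff₀ (by positivity)]

/-- The edge statistic with known noise level is close to the normalised projection of the noise. -/
lemma abs_edgeStat_sub_le (G : SimpleGraph (Fin n)) (e : Edge G) (hN : 0 < N)
    {X : Matrix (Fin N) (Fin n) ℝ} {ε : Fin N → ℝ} {βs βhat : Fin n → ℝ}
    {Θ : Matrix (Fin n) (Fin n) ℝ} {σ μ c₂ : ℝ} (hσ : 0 < σ) (hc₂ : 0 < c₂) (hμ0 : 0 ≤ μ)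
    (hΘ : CLIMEFeasible (sampleCov X) μ Θ)
    (hv : 1 / (4 * c₂) ≤ 1 / N * ((X *ᵥ (Θᵀ *ᵥ incidence G e)) ⬝ᵥ (X *ᵥ (Θᵀ *ᵥ incidence G e)))) :
    |edgeStat G e σ (incidence G e ⬝ᵥ βs) X (X *ᵥ βs + ε) βhat Θ
      - ((X *ᵥ (Θᵀ *ᵥ incidence G e)) ⬝ᵥ ε) /
        √((X *ᵥ (Θᵀ *ᵥ incidence G e)) ⬝ᵥ (X *ᵥ (Θᵀ *ᵥ incidence G e))) / σ|
      ≤ 4 * √c₂ * (√N * μ * (∑ a, |(βhat - βs) a|) / σ) := by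
  set q := X *ᵥ (Θᵀ *ᵥ incidence G e) with hq
  set h := βhat - βs with hh
  have hN' : (0 : ℝ) < N := by exact_mod_cast hN
  set V := √(1 / N * (q ⬝ᵥ q)) with hV
  have hVpos : 0 < V := Real.sqrt_pos.2 (lt_of_lt_of_le (by positivity) hv)
  have hVinv : 1 / V ≤ 2 * √c₂ := by
    rw [div_le_iff₀ hVpos, hV]
    have h1 : √(1 / (4 * c₂)) ≤ √(1 / N * (q ⬝ᵥ q)) := Real.sqrt_le_sqrt hv
    have h2 : 2 * √c₂ * √(1 / (4 * c₂)) = 1 := by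
      have e2 : (2 : ℝ) = √4 := by rw [show (4 : ℝ) = 2 ^ 2 by norm_num]; simp
      rw [e2, ← Real.sqrt_mul (by norm_num), ← Real.sqrt_mul (by positivity)]
      rw [mul_one_div_cancel (by positivity), Real.sqrt_one]
    calc (1 : ℝ) = _ := h2.symm
      _ ≤ _ := by gcongr
  have hqV : √(q ⬝ᵥ q) = √N * V := by
    rw [hV, ← Real.sqrt_mul hN'.le]; congr 1; field_simp
  have hsN : 0 < √(N : ℝ) := Real.sqrt_pos.2 hN'
  have hsNN : √(N : ℝ) * √(N : ℝ) = N := Real.mul_self_sqrt hN'.le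
  set ρ := incidence G e ⬝ᵥ ((Θ * sampleCov X - 1) *ᵥ h) with hρ
  have key : edgeStat G e σ (incidence G e ⬝ᵥ βs) X (X *ᵥ βs + ε) βhat Θ - q ⬝ᵥ ε / √(q ⬝ᵥ q) / σ
      = -(√N * ρ / σ * (1 / V)) := by
    rw [edgeStat, dotProduct_oneStep_sub, dotProduct_sandwich_mulVec, ← hq, ← hV, ← hh, ← hρ, hqV]
    have : 1 / (N : ℝ) = 1 / (√(N : ℝ) * √(N : ℝ)) := by rw [hsNN]
    rw [this]
    field_simp
    ring
  rw [key, abs_neg, abs_mul, abs_div, abs_mul, abs_of_pos hsN, abs_of_pos hσ,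
    abs_of_pos (by positivity : 0 < 1 / V)]
  have h1 : |ρ| ≤ μ * 2 * ∑ a, |h a| := by
    have := abs_dotProduct_mulVec_le hΘ (incidence G e) h
    rwa [sum_abs_incidence] at this
  calc √N * |ρ| / σ * (1 / V) ≤ √N * (μ * 2 * ∑ a, |h a|) / σ * (2 * √c₂) := by gcongr
    _ = _ := by ring

/-- The residual is `ε - X h`: the reverse triangle inequality costs the prediction error `√Q`. For
`E = |ε|/√N`, `|E - σ| = |E² - σ²| / (E + σ) ≤ κ/σ`. -/
lemma abs_sigmaHat_sub_le (hN : 0 < N) (X : Matrix (Fin N) (Fin n) ℝ) (ε : Fin N → ℝ)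
    (βs βhat : Fin n → ℝ) {σ κ Q : ℝ} (hσ : 0 < σ) (hκ : |1 / (N : ℝ) * (ε ⬝ᵥ ε) - σ ^ 2| ≤ κ)
    (hQ : 1 / (N : ℝ) * ((X *ᵥ (βhat - βs)) ⬝ᵥ (X *ᵥ (βhat - βs))) ≤ Q) :
    |sigmaHat X (X *ᵥ βs + ε) βhat - σ| ≤ √Q + κ / σ := by
  set x := X *ᵥ (βhat - βs) with hx
  have hN' : (0 : ℝ) < N := by exact_mod_cast hN
  have e1 : sigmaHat X (X *ᵥ βs + ε) βhat = √(1 / N) * √((ε - x) ⬝ᵥ (ε - x)) := by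
    rw [sigmaHat, ← Real.sqrt_mul (by positivity)]
    congr 2
    simp only [dotProduct]
    refine Finset.sum_congr rfl fun i _ => ?_
    rw [hx, mulVec_sub]
    simp only [Pi.add_apply, Pi.sub_apply]
    ring
  have h1 : |sigmaHat X (X *ᵥ βs + ε) βhat - √(1 / N * (ε ⬝ᵥ ε))| ≤ √Q := by
    rw [e1, Real.sqrt_mul (by positivity), ← mul_sub, abs_mul, abs_of_nonneg (Real.sqrt_nonneg _)]
    calc _ ≤ √(1 / (N : ℝ)) * √(x ⬝ᵥ x) :=
          mul_le_mul_of_nonneg_left (abs_sqrt_sub_sqrt_le ε x) (Real.sqrt_nonneg _)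
      _ = √(1 / (N : ℝ) * (x ⬝ᵥ x)) := (Real.sqrt_mul (by positivity) _).symm
      _ ≤ _ := Real.sqrt_le_sqrt hQ
  have h2 : |√(1 / (N : ℝ) * (ε ⬝ᵥ ε)) - σ| ≤ κ / σ := by
    set E := √(1 / (N : ℝ) * (ε ⬝ᵥ ε)) with hE
    have hE0 : 0 ≤ E := Real.sqrt_nonneg _
    have hEE : 1 / (N : ℝ) * (ε ⬝ᵥ ε) = E ^ 2 :=
      (Real.sq_sqrt (mul_nonneg (by positivity) (dotProduct_self_nonneg_real _))).symm
    rw [hEE, sq_sub_sq, abs_mul, abs_of_pos (by positivity : 0 < E + σ)] at hκ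
    rw [le_div_iff₀ hσ]
    nlinarith [abs_nonneg (E - σ)]
  have h3 := abs_sub_le (sigmaHat X (X *ᵥ βs + ε) βhat) (√(1 / (N : ℝ) * (ε ⬝ᵥ ε))) σ
  linarith

lemma edgeStat_eq_mul (G : SimpleGraph (Fin n)) (e : Edge G) {s σ c : ℝ} (hσ : 0 < σ) (hs : 0 < s)
    (X : Matrix (Fin N) (Fin n) ℝ) (y : Fin N → ℝ) (βhat : Fin n → ℝ)
    (Θ : Matrix (Fin n) (Fin n) ℝ) :
    edgeStat G e s c X y βhat Θ = edgeStat G e σ c X y βhat Θ * (σ / s) := by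
  rw [edgeStat, edgeStat, mul_comm s, mul_comm σ, ← div_div, ← div_div]
  field_simp

/-- Replacing the noise level by an estimate with small relative error changes the statistic
little. -/
lemma abs_edgeStat_sub_edgeStat_le (G : SimpleGraph (Fin n)) (e : Edge G) {s σ c τ : ℝ}
    (hσ : 0 < σ) (hτ : |s - σ| ≤ τ * σ) (hτ2 : τ ≤ 1 / 2)
    (X : Matrix (Fin N) (Fin n) ℝ) (y : Fin N → ℝ) (βhat : Fin n → ℝ)
    (Θ : Matrix (Fin n) (Fin n) ℝ) :
    |edgeStat G e s c X y βhat Θ - edgeStat G e σ c X y βhat Θ|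
      ≤ |edgeStat G e σ c X y βhat Θ| * (2 * τ) := by
  have h1 := abs_le.1 hτ
  have hs : σ / 2 ≤ s := by nlinarith
  have hs0 : 0 < s := by linarith
  rw [edgeStat_eq_mul G e (s := s) hσ hs0, ← mul_sub_one, abs_mul]
  refine mul_le_mul_of_nonneg_left ?_ (abs_nonneg _)
  have e1 : σ / s - 1 = -(s - σ) / s := by field_simp; ring
  rw [e1, abs_div, abs_neg, abs_of_pos hs0, div_le_iff₀ hs0]
  have : 0 ≤ τ := by
    by_contra hcon
    push Not at hcon
    nlinarith [abs_nonneg (s - σ)]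
  nlinarith

end Debiasing

/-! ### Concentration of the sample covariance matrix -/

section Design

variable {Ω : Type*} [MeasurableSpace Ω] {P : Measure Ω} {N n : ℕ} {σx : ℝ}
  {S : Matrix (Fin n) (Fin n) ℝ} {X : Ω → Matrix (Fin N) (Fin n) ℝ}

lemma IsSubGaussianVector.hasSubgaussianMGF_dotProduct [IsProbabilityMeasure P]
    {V : Ω → Fin n → ℝ} (hV : IsSubGaussianVector σx V P) {w : Fin n → ℝ} {l : ℝ}
    (hw : w ⬝ᵥ w ≤ l ^ 2) : HasSubgaussianMGF (fun ω => w ⬝ᵥ V ω) ((σx * l) ^ 2).toNNReal P := by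
  have hw0 := dotProduct_self_nonneg_real w
  rcases hw0.eq_or_lt with h0 | h0
  · have : w = 0 := dotProduct_self_eq_zero.1 h0.symm
    subst this
    refine ⟨fun t => by simp, fun t => ?_⟩
    simp only [zero_dotProduct]
    rw [mgf_const]
    simp only [mul_zero, Real.exp_zero, Real.one_le_exp_iff]
    positivity
  · set m := √(w ⬝ᵥ w) with hm
    have hm0 : 0 < m := Real.sqrt_pos.2 h0
    have hmm : m * m = w ⬝ᵥ w := Real.mul_self_sqrt hw0
    have hu : (m⁻¹ • w) ⬝ᵥ (m⁻¹ • w) = 1 := by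
      rw [smul_dotProduct, dotProduct_smul, smul_eq_mul, smul_eq_mul, ← hmm]
      field_simp
    have hp := (hV.projection _ hu).mgf_bound
    have e : ∀ t ω, t * (w ⬝ᵥ V ω) = (t * m) * ((m⁻¹ • w) ⬝ᵥ V ω) := by
      intro t ω
      rw [smul_dotProduct, smul_eq_mul]
      field_simp
    refine ⟨fun t => ?_, fun t => ?_⟩
    · simp_rw [e]
      exact hp.integrable_exp_mul _
    · have h1 := hp.mgf_le (t * m)
      simp only [mgf] at h1 ⊢
      simp_rw [e]
      refine h1.trans (Real.exp_le_exp.2 ?_)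
      rw [Real.coe_toNNReal _ (by positivity), Real.coe_toNNReal _ (by positivity), mul_pow, mul_pow]
      have h2 : m ^ 2 ≤ l ^ 2 := by rw [sq m, hmm]; exact hw
      have h3 : σx ^ 2 * t ^ 2 * m ^ 2 ≤ σx ^ 2 * t ^ 2 * l ^ 2 := by gcongr
      linarith

lemma single_dotProduct_self (b : Fin n) :
    (Pi.single b 1 : Fin n → ℝ) ⬝ᵥ Pi.single b 1 ≤ (1 : ℝ) ^ 2 := by
  simp

lemma IsSubGaussianVector.hasSubgaussianMGF_apply [IsProbabilityMeasure P]
    {V : Ω → Fin n → ℝ} (hV : IsSubGaussianVector σx V P) (b : Fin n) :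
    HasSubgaussianMGF (fun ω => V ω b) (σx ^ 2).toNNReal P := by
  simpa using hV.hasSubgaussianMGF_dotProduct (single_dotProduct_self b)

lemma IsRowwiseSubGaussian.isHermitian (hX : IsRowwiseSubGaussian σx S X P) (hN : 0 < N) :
    S.IsHermitian := by
  ext a b
  rw [conjTranspose_apply, star_trivial, ← hX.cov_row ⟨0, hN⟩, ← hX.cov_row ⟨0, hN⟩,
    covariance_comm]

lemma IsRowwiseSubGaussian.integral_mul [IsProbabilityMeasure P]
    (hX : IsRowwiseSubGaussian σx S X P) (i : Fin N) (a b : Fin n) :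
    Integrable (fun ω => X ω i a * X ω i b) P ∧ ∫ ω, X ω i a * X ω i b ∂P = S a b := by
  have hm : ∀ a, MemLp (fun ω => X ω i a) 2 P := fun a =>
    ((hX.subGaussian_row i).hasSubgaussianMGF_apply a).memLp 2
  refine ⟨(hm a).integrable_mul (hm b), ?_⟩
  have h := covariance_eq_sub (hm a) (hm b)
  rw [hX.cov_row, (hX.subGaussian_row i).mean_zero, zero_mul, sub_zero] at h
  rw [h]; rfl

lemma IsRowwiseSubGaussian.integral_dotProduct_mul [IsProbabilityMeasure P]
    (hX : IsRowwiseSubGaussian σx S X P) (i : Fin N) (w : Fin n → ℝ) (b : Fin n) :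
    ∫ ω, (w ⬝ᵥ X ω i) * X ω i b ∂P = (w ᵥ* S) b := by
  simp only [dotProduct, vecMul, Finset.sum_mul]
  rw [integral_finsetSum]
  · refine Finset.sum_congr rfl fun a _ => ?_
    simp_rw [mul_assoc]
    rw [integral_const_mul, (hX.integral_mul i a b).2]
  · intro a _
    simp_rw [mul_assoc]
    exact (hX.integral_mul i a b).1.const_mul _

lemma vecMul_sampleCov (x : Matrix (Fin N) (Fin n) ℝ) (w : Fin n → ℝ) (b : Fin n) :
    (w ᵥ* sampleCov x) b = 1 / (N : ℝ) * ∑ i, (w ⬝ᵥ x i) * x i b := by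
  rw [sampleCov, vecMul_smul, Pi.smul_apply, smul_eq_mul, ← vecMul_vecMul, vecMul_transpose]
  congr 1
  simp only [vecMul, dotProduct, mulVec]
  refine Finset.sum_congr rfl fun i _ => ?_
  congr 1
  exact Finset.sum_congr rfl fun a _ => mul_comm _ _

/-- Concentration of a linear combination of the rows of the sample covariance matrix. -/
lemma IsRowwiseSubGaussian.measureReal_vecMul_sampleCov_le [IsProbabilityMeasure P]
    (hX : IsRowwiseSubGaussian σx S X P) (hN : 0 < N) (hσx : 0 < σx) {w : Fin n → ℝ} {l : ℝ}
    (hl : 0 < l) (hw : w ⬝ᵥ w ≤ l ^ 2) (b : Fin n) {r : ℝ} (hr : 0 ≤ r) (hr1 : r ≤ 1) :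
    P.real {ω | 64 * (σx * l) * σx * r < |(w ᵥ* sampleCov (X ω)) b - (w ᵥ* S) b|}
      ≤ 2 * Real.exp (-(4 * (N * r ^ 2))) := by
  simp_rw [vecMul_sampleCov]
  refine measureReal_abs_average_mul_sub_le hN (by positivity) hσx ?_
    (fun i => (hX.subGaussian_row i).hasSubgaussianMGF_dotProduct hw)
    (fun i => (hX.subGaussian_row i).hasSubgaussianMGF_apply b)
    (fun i => hX.integral_dotProduct_mul i w b) hr hr1
  exact hX.indep_rows.comp (fun _ v => (w ⬝ᵥ v) * v b) fun _ => by unfold dotProduct; fun_prop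

lemma IsRowwiseSubGaussian.measureReal_sampleCov_le [IsProbabilityMeasure P]
    (hX : IsRowwiseSubGaussian σx S X P) (hN : 0 < N) (hσx : 0 < σx)
    {r : ℝ} (hr : 0 ≤ r) (hr1 : r ≤ 1) (a b : Fin n) :
    P.real {ω | 64 * σx ^ 2 * r < |(sampleCov (X ω) - S) a b|}
      ≤ 2 * Real.exp (-(4 * (N * r ^ 2))) := by
  have h := hX.measureReal_vecMul_sampleCov_le hN hσx one_pos (single_dotProduct_self a) b hr hr1
  simp only [single_one_vecMul, mul_one] at h
  rw [sq, ← mul_assoc]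
  exact h

/-- The linear-combination bound for `w` a row of `S⁻¹`, with `l = 1/c₁`. It makes `S⁻¹` feasible
for the CLIME problem with high probability. -/
lemma IsRowwiseSubGaussian.measureReal_inv_mul_sampleCov_le [IsProbabilityMeasure P]
    (hX : IsRowwiseSubGaussian σx S X P) (hN : 0 < N) (hσx : 0 < σx) {c₁ c₂ : ℝ} (hc₁ : 0 < c₁)
    (hspec : spectrum ℝ S ⊆ Set.Icc c₁ c₂)
    {r : ℝ} (hr : 0 ≤ r) (hr1 : r ≤ 1) (a b : Fin n) :
    P.real {ω | 64 * σx ^ 2 / c₁ * r < |(S⁻¹ * sampleCov (X ω) - 1) a b|}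
      ≤ 2 * Real.exp (-(4 * (N * r ^ 2))) := by
  have h := hX.measureReal_vecMul_sampleCov_le hN hσx (one_div_pos.2 hc₁)
    (inv_row_dotProduct_self_le hc₁ (hX.isHermitian hN) hspec a) b hr hr1
  have e1 : (S⁻¹ a ᵥ* S) b = (1 : Matrix (Fin n) (Fin n) ℝ) a b := by
    rw [← inv_mul_of_spectrum hc₁ hspec]; rfl
  rw [e1] at h
  have e2 : 64 * σx ^ 2 / c₁ * r = 64 * (σx * (1 / c₁)) * σx * r := by ring
  rw [e2]
  exact h

end Design

/-! ### Normalised directions -/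

section Direction

variable {N : ℕ}

open Classical in
/-- The unit vector in the direction of `q`, a fixed basis vector if `q = 0`. -/
noncomputable def direction (i₀ : Fin N) (q : Fin N → ℝ) : Fin N → ℝ :=
  if q ⬝ᵥ q = 0 then Pi.single i₀ 1 else (√(q ⬝ᵥ q))⁻¹ • q

/-- Unit length holds also at `q = 0`, so the projected noise is exactly standard normal without
conditioning on `q ≠ 0`. -/
lemma direction_dotProduct_self (i₀ : Fin N) (q : Fin N → ℝ) :
    direction i₀ q ⬝ᵥ direction i₀ q = 1 := by
  unfold direction
  split_ifs with h
  · simp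
  · have h0 := (dotProduct_self_nonneg_real q).lt_of_ne' h
    have h1 := Real.sqrt_pos.2 h0
    rw [smul_dotProduct, dotProduct_smul, smul_eq_mul, smul_eq_mul]
    nth_rewrite 3 [← Real.mul_self_sqrt h0.le]
    field_simp

lemma dotProduct_eq_sqrt_mul_direction (i₀ : Fin N) (q v : Fin N → ℝ) :
    q ⬝ᵥ v = √(q ⬝ᵥ q) * (direction i₀ q ⬝ᵥ v) := by
  unfold direction
  split_ifs with h
  · rw [dotProduct_self_eq_zero.1 h]; simp
  · have h0 := (dotProduct_self_nonneg_real q).lt_of_ne' h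
    have h1 := Real.sqrt_pos.2 h0
    rw [smul_dotProduct, smul_eq_mul]
    field_simp

lemma measurable_direction (i₀ : Fin N) : Measurable (direction i₀) := by
  unfold direction
  have h : Measurable fun q : Fin N → ℝ => q ⬝ᵥ q := by unfold dotProduct; fun_prop
  exact Measurable.ite (h (measurableSet_singleton 0)) measurable_const
    (h.sqrt.inv.smul measurable_id)

end Direction

/-! ### Deterministic comparison on the good event -/

section Deterministic

variable {N n : ℕ}

/-- On the event where the design and the noise concentrate, both edge statistics are close to the
normalised projection of the noise. -/
lemma abs_edgeStat_sub_direction_le (G : SimpleGraph (Fin n)) [DecidableRel G.Adj] (e : Edge G)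
    {k s₁ s₂ : ℕ} {ν σx c₁ c₂ C₁ lam μ σ r : ℝ} (i₀ : Fin N)
    (hσx : 0 < σx) (hc₁ : 0 < c₁) (hc₂ : 0 < c₂) (hC₁ : 0 ≤ C₁) (hσ : 0 < σ) (hd : 0 < G.maxDegree)
    (hν : 0 ≤ ν) (hs₁ : 0 < s₁) (hs₂ : 0 < s₂) (hs : ν ≤ (s₂ : ℝ) / s₁)
    {S : Matrix (Fin n) (Fin n) ℝ} (hS : S.IsHermitian) (hspec : spectrum ℝ S ⊆ Set.Icc c₁ c₂)
    {X : Matrix (Fin N) (Fin n) ℝ} {ε : Fin N → ℝ} {βs βhat : Fin n → ℝ}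
    (hβs : βs ∈ paramSpace G k s₁ s₂)
    (hmin : IsGraphLasso G k (lam * √(ν / (2 * (G.maxDegree : ℝ)) ^ (k + 1))) lam X
      (X *ᵥ βs + ε) βhat)
    {Θhat : Matrix (Fin N) (Fin n) ℝ → Matrix (Fin n) (Fin n) ℝ} (hΘhat : IsCLIMEEstimator μ Θhat)
    (hn : 1 < n) (hr : r = √(Real.log n / N))
    (hlam : 4 * √(2 * c₂) * (σ * r) ≤ lam) (hlam' : lam ≤ C₁ * (σ * r))
    (hμ : 64 * σx ^ 2 / c₁ * r ≤ μ) (hμ' : μ ≤ C₁ * r)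
    (hsmall₁ : 36 * s₂ * (64 * σx ^ 2 * r) ≤ c₁ / 2) (hsmall₂ : 2 * (64 * σx ^ 2 * r) ≤ c₂)
    (hsmall₃ : 4 * (C₁ * r) ≤ 1) (hsmall₄ : (√(72 / c₁) * C₁ + 64) * (r * √s₂) ≤ 1 / 2)
    (hcov : ∀ a b, |(sampleCov X - S) a b| ≤ 64 * σx ^ 2 * r)
    (hinv : ∀ a b, |(S⁻¹ * sampleCov X - 1) a b| ≤ 64 * σx ^ 2 / c₁ * r)
    (hcol : ∀ a, |direction i₀ (Xᵀ a) ⬝ᵥ ε / σ| ≤ 2 * √(Real.log n))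
    (hvar : |1 / (N : ℝ) * (ε ⬝ᵥ ε) - σ ^ 2| ≤ 64 * σ ^ 2 * r)
    (hW : |direction i₀ (X *ᵥ ((Θhat X)ᵀ *ᵥ incidence G e)) ⬝ᵥ ε / σ| ≤ 2 * √(Real.log n)) :
    |edgeStat G e σ (incidence G e ⬝ᵥ βs) X (X *ᵥ βs + ε) βhat (Θhat X)
        - direction i₀ (X *ᵥ ((Θhat X)ᵀ *ᵥ incidence G e)) ⬝ᵥ ε / σ|
      ≤ (2 * (288 * √c₂ * C₁ ^ 2 / c₁) + 4 * (√(72 / c₁) * C₁ + 64))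
        * (s₂ * Real.log n / √N) ∧
    |edgeStat G e (sigmaHat X (X *ᵥ βs + ε) βhat) (incidence G e ⬝ᵥ βs) X (X *ᵥ βs + ε) βhat (Θhat X)
        - direction i₀ (X *ᵥ ((Θhat X)ᵀ *ᵥ incidence G e)) ⬝ᵥ ε / σ|
      ≤ (2 * (288 * √c₂ * C₁ ^ 2 / c₁) + 4 * (√(72 / c₁) * C₁ + 64))
        * (s₂ * Real.log n / √N) := by
  have hN : 0 < N := i₀.pos
  have hN' : (0 : ℝ) < N := by exact_mod_cast hN
  have hL : 0 < Real.log n := Real.log_pos (by exact_mod_cast hn)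
  have hr0 : 0 < r := by rw [hr]; positivity
  have hsN : 0 < √(N : ℝ) := Real.sqrt_pos.2 hN'
  have hsNN : √(N : ℝ) * √(N : ℝ) = N := Real.mul_self_sqrt hN'.le
  have hsLL : √(Real.log n) * √(Real.log n) = Real.log n := Real.mul_self_sqrt hL.le
  have hr' : r = √(Real.log n) / √N := by rw [hr, Real.sqrt_div hL.le]
  have hs2 : (1 : ℝ) ≤ s₂ := by exact_mod_cast hs₂
  have hlam0 : 0 < lam := lt_of_lt_of_le (by positivity) hlam
  have hμ0 : 0 ≤ μ := le_trans (by positivity) hμ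
  have hfeas : CLIMEFeasible (sampleCov X) μ (Θhat X) :=
    (hΘhat.solves X ⟨S⁻¹, fun a b => (hinv a b).trans hμ⟩).1
  set q := X *ᵥ ((Θhat X)ᵀ *ᵥ incidence G e) with hq
  set W := direction i₀ q ⬝ᵥ ε / σ with hWdef
  -- A column of `X` has norm at most `√N √(2c₂)`, and the noise along it is at most `2σ√(log n)`.
  -- The result `2√(2c₂) σ r` explains the lower bound on `lam`.
  have hnoise : ∀ a, |1 / (N : ℝ) * (Xᵀ *ᵥ ε) a| ≤ lam / 2 := by
    intro a
    have h1 : (Xᵀ *ᵥ ε) a = √(Xᵀ a ⬝ᵥ Xᵀ a) * (direction i₀ (Xᵀ a) ⬝ᵥ ε) :=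
      dotProduct_eq_sqrt_mul_direction i₀ (Xᵀ a) ε
    have h2 : 1 / (N : ℝ) * (Xᵀ a ⬝ᵥ Xᵀ a) = sampleCov X a a := by
      rw [sampleCov, Matrix.smul_apply, smul_eq_mul]; rfl
    have h3 : S a a ≤ c₂ := by
      have := (dotProduct_mulVec_mem_Icc hS hspec (Pi.single a 1)).2
      simpa using this
    have h4 : 1 / (N : ℝ) * (Xᵀ a ⬝ᵥ Xᵀ a) ≤ 2 * c₂ := by
      have := (abs_le.1 (hcov a a)).2
      rw [Matrix.sub_apply] at this
      have h5 : (0 : ℝ) ≤ 64 * σx ^ 2 * r := by positivity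
      linarith
    have h5 : √(Xᵀ a ⬝ᵥ Xᵀ a) ≤ √N * √(2 * c₂) := by
      rw [← Real.sqrt_mul hN'.le]
      apply Real.sqrt_le_sqrt
      rw [one_div, inv_mul_le_iff₀ hN'] at h4
      exact h4
    have h6 : |direction i₀ (Xᵀ a) ⬝ᵥ ε| ≤ 2 * √(Real.log n) * σ := by
      have := hcol a
      rwa [abs_div, abs_of_pos hσ, div_le_iff₀ hσ] at this
    rw [h1, abs_mul, abs_mul, abs_of_pos (by positivity : (0 : ℝ) < 1 / N),
      abs_of_nonneg (Real.sqrt_nonneg _)]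
    calc 1 / (N : ℝ) * (√(Xᵀ a ⬝ᵥ Xᵀ a) * |direction i₀ (Xᵀ a) ⬝ᵥ ε|)
        ≤ 1 / (N : ℝ) * (√N * √(2 * c₂) * (2 * √(Real.log n) * σ)) := by gcongr
      _ = 4 * √(2 * c₂) * (σ * r) / 2 := by
          rw [hr']; nth_rewrite 1 [← hsNN]; field_simp; ring
      _ ≤ lam / 2 := by linarith
  have hbasic := hmin.basic_inequality G hN hd hν hlam0 hs₁ hs hβs hnoise
  obtain ⟨hl1, hQ⟩ := error_bounds_of_basic_inequality hlam0 hc₁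
    (dotProduct_mulVec_mem_Icc hS hspec (βhat - βs)).1 hcov (by positivity) hsmall₁ hbasic
  have hv := sandwich_variance_ge G e hc₂ (dotProduct_mulVec_mem_Icc hS hspec _).2 hcov hsmall₂
    hfeas (by linarith)
  rw [← hq] at hv
  have hqpos : 0 < q ⬝ᵥ q := by
    by_contra hcon
    have : q ⬝ᵥ q = 0 := le_antisymm (not_lt.1 hcon) (dotProduct_self_nonneg_real q)
    rw [this, mul_zero] at hv
    have : 0 < 1 / (4 * c₂) := by positivity
    linarith
  have hWq : q ⬝ᵥ ε / √(q ⬝ᵥ q) / σ = W := by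
    have := Real.sqrt_pos.2 hqpos
    rw [hWdef, dotProduct_eq_sqrt_mul_direction i₀ q ε]
    field_simp
  have hclose := abs_edgeStat_sub_le G e hN (ε := ε) (βs := βs) (βhat := βhat) hσ hc₂ hμ0 hfeas hv
  rw [← hq, hWq] at hclose
  set δ := s₂ * Real.log n / √N with hδ
  have hδ0 : 0 ≤ δ := by positivity
  set K := 288 * √c₂ * C₁ ^ 2 / c₁ with hK
  have hK0 : 0 ≤ K := by positivity
  set K₂ := √(72 / c₁) * C₁ + 64 with hK₂
  have hK₂0 : 0 ≤ K₂ := by positivity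
  set T := edgeStat G e σ (incidence G e ⬝ᵥ βs) X (X *ᵥ βs + ε) βhat (Θhat X) with hT
  -- Here `288 = 4 · 72`, and the two factors `r` from `μ` and `lam` combine with `√N` to `log n /
  -- √N`.
  have hTW : |T - W| ≤ K * δ := by
    refine hclose.trans ?_
    calc 4 * √c₂ * (√N * μ * (∑ a, |(βhat - βs) a|) / σ)
        ≤ 4 * √c₂ * (√N * (C₁ * r) * (72 * (C₁ * (σ * r)) * s₂ / c₁) / σ) := by
          gcongr
          refine hl1.trans ?_
          gcongr
      _ = 288 * √c₂ * C₁ ^ 2 / c₁ * (s₂ * (√(Real.log n) * √(Real.log n)) / √N) := by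
          rw [hr']; field_simp; ring
      _ = _ := by rw [hsLL]
  set τ := K₂ * (r * √s₂) with hτ
  have hs2r : 1 ≤ √(s₂ : ℝ) := Real.one_le_sqrt.2 hs2
  have hsig : |sigmaHat X (X *ᵥ βs + ε) βhat - σ| ≤ τ * σ := by
    refine (abs_sigmaHat_sub_le hN X ε βs βhat hσ hvar hQ).trans ?_
    have h1 : √(72 * lam ^ 2 * s₂ / c₁) = √(72 / c₁) * lam * √s₂ := by
      rw [show 72 * lam ^ 2 * s₂ / c₁ = 72 / c₁ * lam ^ 2 * s₂ by ring,
        Real.sqrt_mul (by positivity), Real.sqrt_mul (by positivity), Real.sqrt_sq hlam0.le]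
    rw [h1]
    have h2 : 64 * σ ^ 2 * r / σ ≤ 64 * (r * √s₂) * σ := by
      rw [show 64 * σ ^ 2 * r / σ = 64 * (r * 1) * σ by field_simp]
      gcongr
    calc _ ≤ √(72 / c₁) * (C₁ * (σ * r)) * √s₂ + 64 * (r * √s₂) * σ := by gcongr
      _ = _ := by rw [hτ, hK₂]; ring
  have hTT := abs_edgeStat_sub_edgeStat_le G e (c := incidence G e ⬝ᵥ βs) hσ hsig hsmall₄ X
    (X *ᵥ βs + ε) βhat (Θhat X)
  rw [← hT] at hTT
  have hτ0 : 0 ≤ τ := by positivity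
  have hLτ : √(Real.log n) * τ ≤ K₂ * δ := by
    calc √(Real.log n) * τ = K₂ * (√s₂ * (√(Real.log n) * √(Real.log n)) / √N) := by
          rw [hτ, hr']; field_simp
      _ = K₂ * (√s₂ * Real.log n / √N) := by rw [hsLL]
      _ ≤ K₂ * δ := by
          rw [hδ]
          gcongr
          calc √(s₂ : ℝ) ≤ √s₂ * √s₂ := le_mul_of_one_le_left (Real.sqrt_nonneg _) hs2r
            _ = s₂ := Real.mul_self_sqrt (by positivity)
  have hTabs : |T| ≤ 2 * √(Real.log n) + K * δ := by
    have := abs_sub_abs_le_abs_sub T W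
    linarith
  have hKδ : 0 ≤ K * δ := by positivity
  have hK₂δ : 0 ≤ K₂ * δ := by positivity
  refine ⟨hTW.trans (by linarith), ?_⟩
  refine (abs_sub_le _ T W).trans ?_
  -- The estimated level adds `4 √(log n) τ + 2τ K δ ≤ 4 K₂ δ + K δ`, using `2τ ≤ 1`. With `|T - W|
  -- ≤ K δ` this gives `2K + 4K₂`.
  have h1 : |T| * (2 * τ) ≤ (2 * √(Real.log n) + K * δ) * (2 * τ) := by gcongr
  have h2 : K * δ * (2 * τ) ≤ K * δ * 1 := mul_le_mul_of_nonneg_left (by linarith) hKδ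
  linarith

end Deterministic

/-! ### Measurability of the statistics -/

section Measurability

variable {Ω : Type*} [MeasurableSpace Ω] {N n : ℕ}

lemma measurable_dotProduct_of_apply {ι : Type*} [Fintype ι] {u v : Ω → ι → ℝ}
    (hu : ∀ i, Measurable fun ω => u ω i) (hv : ∀ i, Measurable fun ω => v ω i) :
    Measurable fun ω => u ω ⬝ᵥ v ω :=
  Finset.measurable_sum _ fun i _ => (hu i).mul (hv i)

lemma measurable_mulVec_apply {ι κ : Type*} [Fintype κ] {A : Ω → Matrix ι κ ℝ} {v : Ω → κ → ℝ}
    (hA : ∀ i j, Measurable fun ω => A ω i j) (hv : ∀ j, Measurable fun ω => v ω j) (i : ι) :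
    Measurable fun ω => (A ω *ᵥ v ω) i :=
  measurable_dotProduct_of_apply (hA i) hv

lemma measurable_mul_apply {ι κ τ : Type*} [Fintype κ] {A : Ω → Matrix ι κ ℝ}
    {B : Ω → Matrix κ τ ℝ} (hA : ∀ i j, Measurable fun ω => A ω i j)
    (hB : ∀ i j, Measurable fun ω => B ω i j) (i : ι) (j : τ) :
    Measurable fun ω => (A ω * B ω) i j :=
  measurable_dotProduct_of_apply (hA i) fun k => hB k j

lemma measurable_edgeStat (G : SimpleGraph (Fin n)) (e : Edge G) (c : ℝ) {s : Ω → ℝ}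
    {X : Ω → Matrix (Fin N) (Fin n) ℝ} {y : Ω → Fin N → ℝ} {βhat : Ω → Fin n → ℝ}
    {Θ : Ω → Matrix (Fin n) (Fin n) ℝ} (hs : Measurable s) (hX : ∀ i a, Measurable fun ω => X ω i a)
    (hy : ∀ i, Measurable fun ω => y ω i) (hβ : ∀ a, Measurable fun ω => βhat ω a)
    (hΘ : ∀ a b, Measurable fun ω => Θ ω a b) :
    Measurable fun ω => edgeStat G e (s ω) c (X ω) (y ω) (βhat ω) (Θ ω) := by
  have hXt : ∀ a i, Measurable fun ω => (X ω)ᵀ a i := fun a i => hX i a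
  have hΘt : ∀ a b, Measurable fun ω => (Θ ω)ᵀ a b := fun a b => hΘ b a
  have hcov : ∀ a b, Measurable fun ω => sampleCov (X ω) a b := fun a b =>
    (measurable_mul_apply hXt hX a b).const_mul _
  have hone : ∀ a, Measurable fun ω => oneStep (X ω) (y ω) (βhat ω) (Θ ω) a := fun a =>
    (hβ a).add ((measurable_mulVec_apply (measurable_mul_apply hΘ hXt)
      (fun i => (hy i).sub (measurable_mulVec_apply hX hβ i)) a).const_mul _)
  have hnum : Measurable fun ω => incidence G e ⬝ᵥ oneStep (X ω) (y ω) (βhat ω) (Θ ω) :=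
    measurable_dotProduct_of_apply (fun _ => measurable_const) hone
  have hvec : ∀ a, Measurable fun ω =>
      ((Θ ω * sampleCov (X ω) * (Θ ω)ᵀ) *ᵥ incidence G e) a :=
    measurable_mulVec_apply (measurable_mul_apply (measurable_mul_apply hΘ hcov) hΘt)
      fun _ => measurable_const
  have hden : Measurable fun ω =>
      incidence G e ⬝ᵥ ((Θ ω * sampleCov (X ω) * (Θ ω)ᵀ) *ᵥ incidence G e) :=
    measurable_dotProduct_of_apply (fun _ => measurable_const) hvec
  unfold edgeStat
  exact ((hnum.sub_const c).const_mul _).div (hs.mul hden.sqrt)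

lemma measurable_sigmaHat {X : Ω → Matrix (Fin N) (Fin n) ℝ} {y : Ω → Fin N → ℝ}
    {βhat : Ω → Fin n → ℝ} (hX : ∀ i a, Measurable fun ω => X ω i a)
    (hy : ∀ i, Measurable fun ω => y ω i) (hβ : ∀ a, Measurable fun ω => βhat ω a) :
    Measurable fun ω => sigmaHat (X ω) (y ω) (βhat ω) :=
  ((Finset.measurable_sum _ fun i _ =>
    ((hy i).sub (measurable_mulVec_apply hX hβ i)).pow_const 2).const_mul _).sqrt

end Measurability

/-! ### Probability of the good event -/

section Stage

variable {Ω : Type*} [MeasurableSpace Ω] {P : Measure Ω}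

lemma measureReal_exists_le [IsFiniteMeasure P] {ι : Type*} [Fintype ι] {p : ι → Ω → Prop} {c : ℝ}
    (h : ∀ i, P.real {ω | p i ω} ≤ c) : P.real {ω | ∃ i, p i ω} ≤ Fintype.card ι * c := by
  have e : {ω | ∃ i, p i ω} = ⋃ i, {ω | p i ω} := by ext ω; simp
  rw [e]
  refine (measureReal_iUnion_fintype_le _).trans ?_
  calc _ ≤ ∑ _i : ι, c := Finset.sum_le_sum fun i _ => h i
    _ = _ := by simp

variable {N n : ℕ}

/-- The noise, projected on the direction that determines the edge statistic, is standard normal. -/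
lemma map_direction_dotProduct [IsProbabilityMeasure P] {X : Ω → Matrix (Fin N) (Fin n) ℝ}
    {ε : Ω → Fin N → ℝ} {σ : ℝ} (hσ : 0 < σ) (hXm : ∀ i, Measurable fun ω => X ω i)
    (hε : IsGaussianNoise σ ε P) (hind : IndepFun (fun ω i => X ω i) ε P) (i₀ : Fin N)
    {q : Matrix (Fin N) (Fin n) ℝ → Fin N → ℝ}
    (hq : ∀ i, Measurable fun x : Fin N → Fin n → ℝ => q (Matrix.of x) i) :
    P.map (fun ω => direction i₀ (q (X ω)) ⬝ᵥ ε ω / σ) = gaussianReal 0 1 ∧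
      Measurable fun ω => direction i₀ (q (X ω)) ⬝ᵥ ε ω / σ := by
  have hY : Measurable fun ω (i : Fin N) => X ω i := measurable_pi_iff.2 hXm
  have hd : Measurable fun x : Fin N → Fin n → ℝ => direction i₀ (q (Matrix.of x)) :=
    (measurable_direction i₀).comp (measurable_pi_iff.2 hq)
  refine ⟨hε.map_dotProduct_of_indep hσ hY hind hd fun x => direction_dotProduct_self i₀ _, ?_⟩
  exact (measurable_dotProduct_of_apply
    (fun i => (measurable_pi_apply i).comp (hd.comp hY))
    fun i => (measurable_pi_apply i).comp hε.measurable_noise).div_const _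

/-- The direction is a measurable function of the design alone, which is what independence from the
noise requires. -/
lemma measurable_clime_direction (G : SimpleGraph (Fin n)) (e : Edge G) {μ : ℝ}
    {Θhat : Matrix (Fin N) (Fin n) ℝ → Matrix (Fin n) (Fin n) ℝ} (hΘhat : IsCLIMEEstimator μ Θhat)
    (i : Fin N) : Measurable fun x : Fin N → Fin n → ℝ =>
      (Matrix.of x *ᵥ ((Θhat (Matrix.of x))ᵀ *ᵥ incidence G e)) i := by
  set f := incidence G e
  have h1 : ∀ a, Measurable fun x : Fin N → Fin n → ℝ => ((Θhat (Matrix.of x))ᵀ *ᵥ f) a := by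
    intro a
    exact measurable_dotProduct_of_apply (u := fun x b => Θhat (Matrix.of x) b a)
      (v := fun _ => f) (fun b => hΘhat.measurable_entry b a) fun _ => measurable_const
  exact measurable_dotProduct_of_apply (u := fun x : Fin N → Fin n → ℝ => x i)
    (v := fun x => (Θhat (Matrix.of x))ᵀ *ᵥ f)
    (fun a => (measurable_pi_apply a).comp (measurable_pi_apply i)) h1

/-- With high probability, both edge statistics are close to a standard normal variable. -/
lemma measureReal_edgeStat_far_le [IsProbabilityMeasure P] (G : SimpleGraph (Fin n))
    [DecidableRel G.Adj] (e : Edge G)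
    {k s₁ s₂ : ℕ} {ν σx c₁ c₂ C₁ lam μ σ r : ℝ} (i₀ : Fin N)
    (hσx : 0 < σx) (hc₁ : 0 < c₁) (hc₂ : 0 < c₂) (hC₁ : 0 ≤ C₁) (hσ : 0 < σ) (hd : 0 < G.maxDegree)
    (hν : 0 ≤ ν) (hs₁ : 0 < s₁) (hs₂ : 0 < s₂) (hs : ν ≤ (s₂ : ℝ) / s₁)
    {S : Matrix (Fin n) (Fin n) ℝ} (hspec : spectrum ℝ S ⊆ Set.Icc c₁ c₂)
    {X : Ω → Matrix (Fin N) (Fin n) ℝ} {ε : Ω → Fin N → ℝ} {βs : Fin n → ℝ}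
    {βhat : Ω → Fin n → ℝ} (hX : IsRowwiseSubGaussian σx S X P) (hε : IsGaussianNoise σ ε P)
    (hind : IndepFun (fun ω i => X ω i) ε P)
    (hβs : βs ∈ paramSpace G k s₁ s₂)
    (hmin : ∀ᵐ ω ∂P, IsGraphLasso G k (lam * √(ν / (2 * (G.maxDegree : ℝ)) ^ (k + 1))) lam (X ω)
      (X ω *ᵥ βs + ε ω) (βhat ω))
    {Θhat : Matrix (Fin N) (Fin n) ℝ → Matrix (Fin n) (Fin n) ℝ} (hΘhat : IsCLIMEEstimator μ Θhat)
    (hn : 1 < n) (hr : r = √(Real.log n / N)) (hr1 : r ≤ 1)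
    (hlam : 4 * √(2 * c₂) * (σ * r) ≤ lam) (hlam' : lam ≤ C₁ * (σ * r))
    (hμ : 64 * σx ^ 2 / c₁ * r ≤ μ) (hμ' : μ ≤ C₁ * r)
    (hsmall₁ : 36 * s₂ * (64 * σx ^ 2 * r) ≤ c₁ / 2) (hsmall₂ : 2 * (64 * σx ^ 2 * r) ≤ c₂)
    (hsmall₃ : 4 * (C₁ * r) ≤ 1) (hsmall₄ : (√(72 / c₁) * C₁ + 64) * (r * √s₂) ≤ 1 / 2) :
    P.real {ω | (2 * (288 * √c₂ * C₁ ^ 2 / c₁) + 4 * (√(72 / c₁) * C₁ + 64))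
        * (s₂ * Real.log n / √N) <
      |edgeStat G e σ (incidence G e ⬝ᵥ βs) (X ω) (X ω *ᵥ βs + ε ω) (βhat ω) (Θhat (X ω))
        - direction i₀ (X ω *ᵥ ((Θhat (X ω))ᵀ *ᵥ incidence G e)) ⬝ᵥ ε ω / σ|} ≤ 10 / n ∧
    P.real {ω | (2 * (288 * √c₂ * C₁ ^ 2 / c₁) + 4 * (√(72 / c₁) * C₁ + 64))
        * (s₂ * Real.log n / √N) <
      |edgeStat G e (sigmaHat (X ω) (X ω *ᵥ βs + ε ω) (βhat ω)) (incidence G e ⬝ᵥ βs) (X ω)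
          (X ω *ᵥ βs + ε ω) (βhat ω) (Θhat (X ω))
        - direction i₀ (X ω *ᵥ ((Θhat (X ω))ᵀ *ᵥ incidence G e)) ⬝ᵥ ε ω / σ|} ≤ 10 / n := by
  have hN : 0 < N := i₀.pos
  have hN' : (0 : ℝ) < N := by exact_mod_cast hN
  have hn' : (1 : ℝ) ≤ n := by exact_mod_cast hn.le
  have hn0 : (0 : ℝ) < n := by linarith
  have hL : 0 < Real.log n := Real.log_pos (by exact_mod_cast hn)
  have hr0 : 0 ≤ r := by rw [hr]; positivity
  -- At `r = √(log n / N)` the Bernstein bound is of order `n⁻⁴`, enough for the `n²` matrix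
  -- entries; the Gaussian threshold `2√(log n)` gives order `n⁻²`, enough for the `n` columns.
  have hexp4 : Real.exp (-(4 * (N * r ^ 2))) = 1 / (n : ℝ) ^ 4 := by
    rw [hr, Real.sq_sqrt (by positivity), mul_div_cancel₀ _ hN'.ne', Real.exp_neg, mul_comm,
      Real.exp_mul, Real.exp_log hn0, one_div]
    norm_cast
  have hexp2 : Real.exp (-((2 * √(Real.log n)) ^ 2 / 2)) = 1 / (n : ℝ) ^ 2 := by
    rw [mul_pow, Real.sq_sqrt hL.le, show (2 : ℝ) ^ 2 * Real.log n / 2 = Real.log n * 2 by ring,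
      Real.exp_neg, Real.exp_mul, Real.exp_log hn0, one_div]
    norm_cast
  have b₁ := measureReal_exists_le fun a => measureReal_exists_le fun b =>
    hX.measureReal_sampleCov_le hN hσx hr0 hr1 a b
  have b₂ := measureReal_exists_le fun a => measureReal_exists_le fun b =>
    hX.measureReal_inv_mul_sampleCov_le hN hσx hc₁ hspec hr0 hr1 a b
  have b₃ := measureReal_exists_le fun a : Fin n =>
    have h := map_direction_dotProduct hσ hX.measurable_row hε hind i₀ (q := fun x => xᵀ a)
      fun i => (measurable_pi_apply a).comp (measurable_pi_apply i)
    measureReal_abs_gt_le_of_map_eq_gaussianReal h.1 h.2.aemeasurable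
      (by positivity : 0 ≤ 2 * √(Real.log n))
  have b₄ := measureReal_abs_average_mul_sub_le hN hσ hσ
    (hε.indep.comp (fun _ z => z * z) fun _ => by fun_prop) hε.hasSubgaussianMGF
    hε.hasSubgaussianMGF hε.integral_mul_self hr0 hr1
  have b₅ := by
    have h := map_direction_dotProduct hσ hX.measurable_row hε hind i₀
      (q := fun x => x *ᵥ ((Θhat x)ᵀ *ᵥ incidence G e)) (measurable_clime_direction G e hΘhat)
    exact measureReal_abs_gt_le_of_map_eq_gaussianReal h.1 h.2.aemeasurable
      (by positivity : 0 ≤ 2 * √(Real.log n))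
  rw [hexp4, Fintype.card_fin] at b₁ b₂
  rw [hexp2, Fintype.card_fin] at b₃
  rw [hexp4] at b₄
  rw [hexp2] at b₅
  have b₆ : P.real {ω | ¬ IsGraphLasso G k (lam * √(ν / (2 * (G.maxDegree : ℝ)) ^ (k + 1))) lam
      (X ω) (X ω *ᵥ βs + ε ω) (βhat ω)} ≤ 0 := by
    rw [measureReal_def, ae_iff.1 hmin]
    simp
  have hbad := (measureReal_union_le _ _).trans (add_le_add ((measureReal_union_le _ _).trans
    (add_le_add ((measureReal_union_le _ _).trans (add_le_add ((measureReal_union_le _ _).trans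
    (add_le_add ((measureReal_union_le _ _).trans (add_le_add b₁ b₂)) b₃)) b₄)) b₅)) b₆)
  have hnum : n * (n * (2 * (1 / (n : ℝ) ^ 4))) + n * (n * (2 * (1 / (n : ℝ) ^ 4)))
      + n * (2 * (1 / (n : ℝ) ^ 2)) + 2 * (1 / (n : ℝ) ^ 4) + 2 * (1 / (n : ℝ) ^ 2) + 0
      ≤ 10 / n := by
    have e1 : n * (n * (2 * (1 / (n : ℝ) ^ 4))) = 2 * (1 / (n : ℝ) ^ 2) := by field_simp
    have e2 : n * (2 * (1 / (n : ℝ) ^ 2)) = 2 * (1 / (n : ℝ)) := by field_simp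
    have h2 : 1 / (n : ℝ) ^ 2 ≤ 1 / n := one_div_le_one_div_of_le hn0 (by nlinarith)
    have h4 : 1 / (n : ℝ) ^ 4 ≤ 1 / n :=
      one_div_le_one_div_of_le hn0 (le_self_pow₀ hn' (by norm_num))
    rw [e1, e2, show (10 : ℝ) / n = 10 * (1 / n) by ring]
    linarith
  have key := fun ω g₁ g₂ g₃ g₄ g₅ g₆ =>
    abs_edgeStat_sub_direction_le G e (X := X ω) (ε := ε ω) (βs := βs) (βhat := βhat ω) i₀ hσx hc₁
      hc₂ hC₁ hσ hd hν hs₁ hs₂ hs (hX.isHermitian hN) hspec hβs g₆ hΘhat hn hr hlam hlam' hμ hμ'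
      hsmall₁ hsmall₂ hsmall₃ hsmall₄ g₁ g₂ g₃ g₄ g₅
  refine ⟨(measureReal_mono ?_).trans (hbad.trans hnum),
    (measureReal_mono ?_).trans (hbad.trans hnum)⟩
  all_goals
    intro ω hω
    by_contra hnot
    simp only [Set.mem_union, Set.mem_ofPred_eq, not_or, not_exists, not_lt, not_not] at hnot
    obtain ⟨⟨⟨⟨⟨g₁, g₂⟩, g₃⟩, g₄⟩, g₅⟩, g₆⟩ := hnot
    have g₄' : |1 / (N : ℝ) * (ε ω ⬝ᵥ ε ω) - σ ^ 2| ≤ 64 * σ ^ 2 * r := by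
      rw [show 64 * σ ^ 2 * r = 64 * σ * σ * r by ring]
      exact g₄
    have := key ω g₁ g₂ g₃ g₄' g₅ g₆
  · exact this.1.not_gt hω
  · exact this.2.not_gt hω

end Stage

end GraphLasso

/-! ### Asymptotic normality and level of the tests -/

theorem corollary4 (σx c₁ c₂ : ℝ) (hσx : 0 < σx) (hc₁ : 0 < c₁) (hc₂ : 0 < c₂) :
    ∃ C₀ : ℝ, 0 < C₀ ∧ ∀ (C₁ : ℝ) (k : ℕ) (ν : ℝ), 0 ≤ ν → ν < 1 →
    -- sample sizes, dimensions, graphs, sparsity levels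
    ∀ (N n s₁ s₂ : ℕ → ℕ) (G : ∀ t, SimpleGraph (Fin (n t))) [∀ t, DecidableRel (G t).Adj]
      -- true parameters, covariance matrices, bounds, noise levels, tuning parameters
      (βs : ∀ t, Fin (n t) → ℝ) (Sx : ∀ t, Matrix (Fin (n t)) (Fin (n t)) ℝ)
      (M σε lam μ : ℕ → ℝ)
      -- probability spaces, designs, noise, responses, estimators, and one edge at each stage
      (Ω : ℕ → Type*) [∀ t, MeasurableSpace (Ω t)] (P : ∀ t, Measure (Ω t))
      [∀ t, IsProbabilityMeasure (P t)]
      (X : ∀ t, Ω t → Matrix (Fin (N t)) (Fin (n t)) ℝ) (ε : ∀ t, Ω t → Fin (N t) → ℝ)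
      (y : ∀ t, Ω t → Fin (N t) → ℝ) (βhat : ∀ t, Ω t → Fin (n t) → ℝ)
      (Θhat : ∀ t, Matrix (Fin (N t)) (Fin (n t)) ℝ → Matrix (Fin (n t)) (Fin (n t)) ℝ)
      (j : ∀ t, GraphLasso.Edge (G t)),
    (∀ t, 0 < N t) → Tendsto n atTop atTop →
    (∀ t, 2 ≤ (G t).maxDegree) →
    (∀ t, 0 < s₁ t) → (∀ t, 0 < s₂ t) → (∀ t, ν ≤ (s₂ t : ℝ) / (s₁ t : ℝ)) →
    (∀ t, βs t ∈ GraphLasso.paramSpace (G t) k (s₁ t) (s₂ t)) →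
    (∀ t, 0 < σε t) →
    -- the linear model with random design and Gaussian noise
    (∀ t ω, y t ω = X t ω *ᵥ βs t + ε t ω) →
    (∀ t, GraphLasso.IsRowwiseSubGaussian σx (Sx t) (X t) (P t)) →
    (∀ t, spectrum ℝ (Sx t) ⊆ Set.Icc c₁ c₂) →
    (∀ t a, ∑ b, |(Sx t)⁻¹ a b| ≤ M t) →
    (∀ t, GraphLasso.IsGaussianNoise (σε t) (ε t) (P t)) →
    (∀ t, IndepFun (fun ω i => X t ω i) (ε t) (P t)) →
    -- the tuning parameters
    (∀ t, C₀ * (σε t * √(Real.log (n t) / N t)) ≤ lam t ∧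
      lam t ≤ C₁ * (σε t * √(Real.log (n t) / N t))) →
    (∀ t, C₀ * √(Real.log (n t) / N t) ≤ μ t ∧ μ t ≤ C₁ * √(Real.log (n t) / N t)) →
    -- the estimators
    (∀ t, Measurable (βhat t)) →
    (∀ t, ∀ᵐ ω ∂(P t), GraphLasso.IsGraphLasso (G t) k
      (lam t * √(ν / (2 * ((G t).maxDegree : ℝ)) ^ (k + 1))) (lam t) (X t ω)
      (y t ω) (βhat t ω)) →
    (∀ t, GraphLasso.IsCLIMEEstimator (μ t) (Θhat t)) →
    -- the growth conditions
    Tendsto (fun t => ((G t).maxDegree : ℝ) * M t * √(Real.log (n t) / N t)) atTop (𝓝 0) →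
    Tendsto (fun t => (s₂ t : ℝ) * Real.log (n t) * √(((G t).maxDegree : ℝ) / N t))
      atTop (𝓝 0) →
    -- asymptotic normality with known and with estimated noise level
    TendstoInDistribution
      (fun t ω => GraphLasso.edgeStat (G t) (j t) (σε t) (GraphLasso.incidence (G t) (j t) ⬝ᵥ βs t)
        (X t ω) (y t ω) (βhat t ω) (Θhat t (X t ω)))
      atTop (id : ℝ → ℝ) P (gaussianReal 0 1) ∧
    TendstoInDistribution
      (fun t ω => GraphLasso.edgeStat (G t) (j t) (GraphLasso.sigmaHat (X t ω) (y t ω) (βhat t ω))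
        (GraphLasso.incidence (G t) (j t) ⬝ᵥ βs t)
        (X t ω) (y t ω) (βhat t ω) (Θhat t (X t ω)))
      atTop (id : ℝ → ℝ) P (gaussianReal 0 1) ∧
    -- the resulting tests of equality along the edges have asymptotic level `α`
    ∀ α z : ℝ, 0 < α → α < 1 → cdf (gaussianReal 0 1) z = 1 - α / 2 →
      (∀ t, βs t (j t).1.1 = βs t (j t).1.2) →
      Tendsto (fun t => (P t).real {ω | z < |GraphLasso.edgeStat (G t) (j t) (σε t) 0
        (X t ω) (y t ω) (βhat t ω) (Θhat t (X t ω))|})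
        atTop (𝓝 α) ∧
      Tendsto (fun t => (P t).real {ω | z < |GraphLasso.edgeStat (G t) (j t) (GraphLasso.sigmaHat (X t ω) (y t ω) (βhat t ω)) 0
        (X t ω) (y t ω) (βhat t ω) (Θhat t (X t ω))|})
        atTop (𝓝 α) := by
  -- The first entry makes `Σ_x⁻¹` feasible for the CLIME constraint; the second lets `λ` dominate
  -- twice the noise correlations.
  refine ⟨max (64 * σx ^ 2 / c₁) (4 * √(2 * c₂)), lt_max_of_lt_left (by positivity), ?_⟩
  intro C₁ k ν hν _ N n s₁ s₂ G _ βs Sx M σε lam μ Ω _ P _ X ε y βhat Θhat j hN hn hd hs₁ hs₂ hs hβs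
    hσ hy hX hspec _ hε hind hlam hμ hβm hmin hΘ _ hgrow
  obtain rfl : y = fun t ω => X t ω *ᵥ βs t + ε t ω := by
    funext t ω
    exact hy t ω
  -- The chosen edge has two distinct endpoints, so `log n > 0` at every stage and not only
  -- eventually.
  have hn1 : ∀ t, 1 < n t := fun t => by
    have h1 := (j t).2.1
    have h2 := (j t).1.2.2
    omega
  have hN' : ∀ t, (0 : ℝ) < N t := fun t => by exact_mod_cast hN t
  have hL : ∀ t, 1 / 4 ≤ Real.log (n t) := fun t => by
    have h1 : Real.log 2 ≤ Real.log (n t) :=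
      Real.log_le_log (by norm_num) (by exact_mod_cast hn1 t)
    linarith [Real.log_two_gt_d9]
  have hL0 : ∀ t, 0 < Real.log (n t) := fun t => by linarith [hL t]
  set r : ℕ → ℝ := fun t => √(Real.log (n t) / N t) with hr
  have hr0 : ∀ t, 0 < r t := fun t => Real.sqrt_pos.2 (div_pos (hL0 t) (hN' t))
  -- The sign of `C₁` is forced by the nonempty range for `μ`.
  have hC₁ : 0 ≤ C₁ := by
    have h1 : max (64 * σx ^ 2 / c₁) (4 * √(2 * c₂)) * r 0 ≤ C₁ * r 0 := (hμ 0).1.trans (hμ 0).2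
    have h2 := le_of_mul_le_mul_right h1 (hr0 0)
    exact le_trans (le_max_of_le_left (by positivity)) h2
  have hs₂' : ∀ t, (1 : ℝ) ≤ s₂ t := fun t => by exact_mod_cast hs₂ t
  have hδ : Tendsto (fun t => (s₂ t : ℝ) * Real.log (n t) / √(N t)) atTop (𝓝 0) := by
    refine squeeze_zero (fun t => by have := hL0 t; positivity) (fun t => ?_) hgrow
    have h1 : (1 : ℝ) ≤ √((G t).maxDegree : ℝ) :=
      Real.one_le_sqrt.2 (by exact_mod_cast one_le_two.trans (hd t))
    have := hL0 t
    have e : (s₂ t : ℝ) * Real.log (n t) * √((G t).maxDegree / N t)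
        = s₂ t * Real.log (n t) / √(N t) * √((G t).maxDegree : ℝ) := by
      rw [Real.sqrt_div (by positivity)]; ring
    rw [e]
    exact le_mul_of_one_le_right (by positivity) h1
  -- Since `log n ≥ 1/4`, `√(log n) ≤ 2 log n`, so `s₂ r` is dominated by the rate `s₂ log n / √N`.
  have hsr : Tendsto (fun t => (s₂ t : ℝ) * r t) atTop (𝓝 0) := by
    refine squeeze_zero (fun t => by have := hr0 t; positivity) (fun t => ?_)
      (by simpa using hδ.const_mul 2)
    have h1 : 1 ≤ 2 * √(Real.log (n t)) := by
      have h2 : √(1 / 4) ≤ √(Real.log (n t)) := Real.sqrt_le_sqrt (hL t)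
      have h3 : √(1 / 4 : ℝ) = 1 / 2 := by
        rw [show (1 / 4 : ℝ) = (1 / 2) ^ 2 by norm_num, Real.sqrt_sq (by norm_num)]
      linarith
    have h4 : √(Real.log (n t)) ≤ 2 * Real.log (n t) := by
      nlinarith [Real.mul_self_sqrt (hL0 t).le, Real.sqrt_nonneg (Real.log (n t))]
    simp only [hr]
    rw [Real.sqrt_div (hL0 t).le]
    calc (s₂ t : ℝ) * (√(Real.log (n t)) / √(N t)) ≤ s₂ t * (2 * Real.log (n t) / √(N t)) := by
          gcongr
      _ = _ := by ring
  have hrlim : Tendsto r atTop (𝓝 0) :=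
    squeeze_zero (fun t => (hr0 t).le) (fun t => le_mul_of_one_le_left (hr0 t).le (hs₂' t)) hsr
  have hrs : Tendsto (fun t => r t * √(s₂ t : ℝ)) atTop (𝓝 0) := by
    refine squeeze_zero (fun t => by have := hr0 t; positivity) (fun t => ?_) hsr
    rw [mul_comm]
    refine mul_le_mul_of_nonneg_right ?_ (hr0 t).le
    exact Real.sqrt_le_self_iff.2 (Or.inr (hs₂' t))
  have small : ∀ {u : ℕ → ℝ} (c : ℝ) {b : ℝ}, 0 < b → Tendsto u atTop (𝓝 0) →
      ∀ᶠ t in atTop, c * u t ≤ b := by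
    intro u c b hb hu
    have h1 : Tendsto (fun t => c * u t) atTop (𝓝 0) := by simpa using hu.const_mul c
    exact (h1.eventually_lt_const hb).mono fun t ht => ht.le
  have hp : Tendsto (fun t => (10 : ℝ) / n t) atTop (𝓝 0) :=
    (tendsto_natCast_atTop_atTop.comp hn).const_div_atTop 10
  set B := 2 * (288 * √c₂ * C₁ ^ 2 / c₁) + 4 * (√(72 / c₁) * C₁ + 64) with hB
  have hBδ : Tendsto (fun t => B * ((s₂ t : ℝ) * Real.log (n t) / √(N t))) atTop (𝓝 0) := by
    simpa using hδ.const_mul B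
  have hev := (small 1 one_pos hrlim).and
    ((small (36 * (64 * σx ^ 2)) (by positivity : 0 < c₁ / 2) hsr).and
    ((small (2 * (64 * σx ^ 2)) hc₂ hrlim).and ((small (4 * C₁) one_pos hrlim).and
    (small (√(72 / c₁) * C₁ + 64) one_half_pos hrs))))
  have hlam₁ : ∀ t, 4 * √(2 * c₂) * (σε t * r t) ≤ lam t := fun t =>
    le_trans (mul_le_mul_of_nonneg_right (le_max_right _ _) (mul_pos (hσ t) (hr0 t)).le) (hlam t).1
  have hμ₁ : ∀ t, 64 * σx ^ 2 / c₁ * r t ≤ μ t := fun t =>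
    le_trans (mul_le_mul_of_nonneg_right (le_max_left _ _) (hr0 t).le) (hμ t).1
  have hfar := fun t (h : 1 * r t ≤ 1 ∧ 36 * (64 * σx ^ 2) * (s₂ t * r t) ≤ c₁ / 2 ∧
      2 * (64 * σx ^ 2) * r t ≤ c₂ ∧ 4 * C₁ * r t ≤ 1 ∧
      (√(72 / c₁) * C₁ + 64) * (r t * √(s₂ t : ℝ)) ≤ 1 / 2) =>
    GraphLasso.measureReal_edgeStat_far_le (P := P t) (G t) (j t) ⟨0, hN t⟩ hσx hc₁ hc₂ hC₁
      (hσ t) (two_pos.trans_le (hd t)) hν (hs₁ t) (hs₂ t) (hs t) (hspec t) (hX t) (hε t) (hind t)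
      (hβs t) (hmin t) (hΘ t) (hn1 t) rfl (by linarith [h.1]) (hlam₁ t) (hlam t).2 (hμ₁ t) (hμ t).2
      (by linarith [h.2.1]) (by linarith [h.2.2.1]) (by linarith [h.2.2.2.1]) h.2.2.2.2
  have hXm : ∀ t i a, Measurable fun ω => X t ω i a := fun t i a =>
    (measurable_pi_apply a).comp ((hX t).measurable_row i)
  have hym : ∀ t i, Measurable fun ω => (X t ω *ᵥ βs t + ε t ω) i := fun t i =>
    (GraphLasso.measurable_mulVec_apply (v := fun _ => βs t) (hXm t) (fun _ => measurable_const) i).add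
      ((measurable_pi_apply i).comp (hε t).measurable_noise)
  have hβm' : ∀ t a, Measurable fun ω => βhat t ω a := fun t a =>
    (measurable_pi_apply a).comp (hβm t)
  have hΘm : ∀ t a b, Measurable fun ω => Θhat t (X t ω) a b := fun t a b =>
    ((hΘ t).measurable_entry a b).comp (measurable_pi_iff.2 (hX t).measurable_row)
  have hW := fun t => GraphLasso.map_direction_dotProduct (P := P t) (hσ t) (hX t).measurable_row
    (hε t) (hind t) ⟨0, hN t⟩
    (q := fun x => x *ᵥ ((Θhat t x)ᵀ *ᵥ GraphLasso.incidence (G t) (j t)))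
    (GraphLasso.measurable_clime_direction (G t) (j t) (hΘ t))
  have hT₁ := GraphLasso.tendstoInDistribution_gaussianReal_of_close
    (fun t => (GraphLasso.measurable_edgeStat (G t) (j t) (GraphLasso.incidence (G t) (j t) ⬝ᵥ βs t)
      (measurable_const (a := σε t)) (hXm t) (hym t) (hβm' t) (hΘm t)).aemeasurable)
    (fun t => (hW t).2.aemeasurable) (fun t => (hW t).1) hBδ hp (hev.mono fun t h => (hfar t h).1)
  have hT₂ := GraphLasso.tendstoInDistribution_gaussianReal_of_close
    (fun t => (GraphLasso.measurable_edgeStat (G t) (j t) (GraphLasso.incidence (G t) (j t) ⬝ᵥ βs t)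
      (GraphLasso.measurable_sigmaHat (hXm t) (hym t) (hβm' t)) (hXm t) (hym t) (hβm' t)
      (hΘm t)).aemeasurable)
    (fun t => (hW t).2.aemeasurable) (fun t => (hW t).1) hBδ hp (hev.mono fun t h => (hfar t h).2)
  refine ⟨hT₁, hT₂, fun α z _ hα1 hz hnull => ?_⟩
  -- Under the null hypothesis the centring vanishes, so the test statistic is the one shown to be
  -- asymptotically normal.
  have hzero : ∀ t, GraphLasso.incidence (G t) (j t) ⬝ᵥ βs t = 0 := fun t => by
    rw [GraphLasso.incidence_dotProduct, hnull t, sub_self]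
  have h₁ := GraphLasso.tendsto_measureReal_abs_gt hT₁ hα1 hz
  have h₂ := GraphLasso.tendsto_measureReal_abs_gt hT₂ hα1 hz
  simp only [hzero] at h₁ h₂
  exact ⟨h₁, h₂⟩
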